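/- **Notions.** A *causal operational-probabilistic theory* consists of systems with a trivial system $I$ and composite systems, and of *tests* $\{\mathcal C_i\}_{i\in O}$ from a system $A$ to a system $B$ with finite outcome sets $O$, whose members are called *events*. Systems and events form part of a symmetric monoidal category, the identity and structural morphisms are one-outcome tests, and tests are closed under sequential and parallel composition, with pairs of outcomes as outcomes. Every test from $I$ to $I$ is a probability distribution on its outcome set, and such tests compose to product distributions. Every system $A$ has a deterministic effect, i.e. a one-outcome test $\top_A$ from $A$ to $I$, and it is unique up to operational equivalence: for every event $\rho$ from $I$ to $A$ and every test $\{a_i\}_{i}$ from $A$ to $I$, the sum over $i$ of the probabilities of $\rho$ followed by $a_i$ equals the probability of $\rho$ followed by $\top_A$ (causality). A *generalised DAG* $G$ is a finite directed acyclic graph whose nodes are partitioned into observed and unobserved nodes; an edge is *unobserved* if it begins on an unobserved node. Let each observed node carry a random variable with a finite set of values. A joint probability distribution $P$ of these variables is *generalised Markov* with respect to $G$ if there are a causal operational-probabilistic theory, a system for each unobserved edge (each edge being a wire of its own), and, for each node and each value of the variables at its observed parents, a test from the composite of the systems on the incoming unobserved edges of the node to the composite of the systems on its outgoing unobserved edges,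 whose outcome set is the set of values of the node's variable if the node is observed and has one element if it is unobserved, such that for every joint value $x$ of the observed variables $P(x)$ is the probability of the closed circuit obtained by connecting, along the unobserved edges, the events selected by $x$. For a set $U$ of nodes let $m(U)$ be the union of $U$ with all children of nodes of $U$. For disjoint sets $X,Y,Z$ of nodes let $W$ be the set of nodes that are neither in $X\cup Y\cup Z$ nor ancestors of a node of $X\cup Y\cup Z$. A *pseudo-path* from $p_1$ to $p_k$ is a finite sequence of nodes $(p_1,\dots,p_k)$, $k \ge 1$, with $p_i\notin W$ for $1\le i\le k$ and $m(\{p_i\})\cap m(\{p_{i+1}\})\not\subseteq W$ for $1\le i<k$. The sets $X$ and $Y$ are *$d$-separated* by $Z$ if, for all $a\in X$ and $b\in Y$, every pseudo-path from $a$ to $b$ contains a node of $Z$. For disjoint sets $X,Y,Z$ of observed nodes, $X\perp Y\mid Z$ in $P$ means that $P(x,y\mid z)=P(x\mid z)\,P(y\mid z)$ for all values $x,y,z$ of the variables in $X,Y,Z$ with $P(z)>0$. **Theorem.** Let $G$ be a generalised DAG and let $X$, $Y$, $Z$ be pairwise disjoint sets of observed nodes of $G$. (i) If $P$ is generalised Markov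 with respect to $G$ and $X$ and $Y$ are $d$-separated by $Z$, then $X\perp Y\mid Z$ in $P$. (ii) If $X\perp Y\mid Z$ holds in every $P$ (for all choices of finite value sets of the observed variables) that is generalised Markov with respect to $G$, then $X$ and $Y$ are $d$-separated by $Z$. -/

import Mathlib

open CategoryTheory MonoidalCategory

universe u w

/-! ### Causal operational-probabilistic theories -/

/-- A causal operational-probabilistic theory whose systems are the objects of a symmetric monoidal
category `C` (`⊗` forms composite systems, `𝟙_ C` is the trivial system, `≫` and `⊗ₘ` are sequential
and parallel composition). The *tests* are distinguished finite families of morphisms; the *events*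
are the morphisms that occur in some test. Morphisms of `C` that occur in no test play no role. -/
structure CausalOPT (C : Type (u + 1)) [LargeCategory C] [MonoidalCategory C]
    [SymmetricCategory C] where
  /-- `IsTest t`: the family of events `t`, indexed by the finite outcome set `X`, is a test. -/
  IsTest : ∀ {X : Type} [Finite X] {A B : C}, (X → (A ⟶ B)) → Prop
  /-- Doing nothing, and the structural rewirings, are deterministic tests. -/
  isTest_id : ∀ A : C, IsTest (fun _ : Unit => 𝟙 A)
  isTest_associator_hom : ∀ A B D : C, IsTest (fun _ : Unit => (α_ A B D).hom)
  isTest_associator_inv : ∀ A B D : C, IsTest (fun _ : Unit => (α_ A B D).inv)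
  isTest_leftUnitor_hom : ∀ A : C, IsTest (fun _ : Unit => (λ_ A).hom)
  isTest_leftUnitor_inv : ∀ A : C, IsTest (fun _ : Unit => (λ_ A).inv)
  isTest_rightUnitor_hom : ∀ A : C, IsTest (fun _ : Unit => (ρ_ A).hom)
  isTest_rightUnitor_inv : ∀ A : C, IsTest (fun _ : Unit => (ρ_ A).inv)
  isTest_braiding : ∀ A B : C, IsTest (fun _ : Unit => (β_ A B).hom)
  /-- Sequential composition of tests; outcomes are ordered pairs. -/
  isTest_comp : ∀ {X Y : Type} [Finite X] [Finite Y] {A B D : C} (s : X → (A ⟶ B))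
    (t : Y → (B ⟶ D)), IsTest s → IsTest t → IsTest (fun p : X × Y => s p.1 ≫ t p.2)
  /-- Parallel composition of tests; outcomes are ordered pairs. -/
  isTest_tensor : ∀ {X Y : Type} [Finite X] [Finite Y] {A B D E : C} (s : X → (A ⟶ B))
    (t : Y → (D ⟶ E)), IsTest s → IsTest t → IsTest (fun p : X × Y => s p.1 ⊗ₘ t p.2)
  /-- The probability of an event from the trivial system to itself. -/
  prob : (𝟙_ C ⟶ 𝟙_ C) → ℝ
  /-- Every test from the trivial system to itself is a probability distribution. -/
  prob_test : ∀ {X : Type} [Fintype X] (t : X → (𝟙_ C ⟶ 𝟙_ C)), IsTest t →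
    (fun x => prob (t x)) ∈ stdSimplex ℝ X
  /-- Composing tests from the trivial system to itself gives the product distribution (on the
  trivial system sequential and parallel composition agree, up to the unitors). -/
  prob_comp : ∀ {X Y : Type} [Finite X] [Finite Y] (s : X → (𝟙_ C ⟶ 𝟙_ C))
    (t : Y → (𝟙_ C ⟶ 𝟙_ C)), IsTest s → IsTest t →
    ∀ x y, prob (s x ≫ t y) = prob (s x) * prob (t y)
  /-- Causality, existence: every system has a deterministic effect. -/
  exists_deterministic : ∀ A : C, ∃ e : A ⟶ 𝟙_ C, IsTest (fun _ : Unit => e)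
  /-- Causality, uniqueness: ignoring the outcome of any observation-test on `A` has, on every
  preparation-event of `A`, the same probability as any deterministic effect on `A` (for a
  one-outcome observation-test this says that deterministic effects are operationally equal). -/
  deterministic_unique : ∀ {X Y : Type} [Fintype X] [Finite Y] {A : C} (a : X → (A ⟶ 𝟙_ C))
    (e : A ⟶ 𝟙_ C) (r : Y → (𝟙_ C ⟶ A)), IsTest a → IsTest (fun _ : Unit => e) → IsTest r →
    ∀ y, ∑ x, prob (r y ≫ a x) = prob (r y ≫ e)

/-! ### Generalised DAGs and d-separation -/

/-- A generalised DAG: a directed acyclic graph on the nodes `V` with a set of observed nodes; the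
remaining nodes are unobserved. -/
structure GDAG (V : Type w) where
  edge : V → V → Prop
  acyclic : ∀ v, ¬ Relation.TransGen edge v v
  observed : Finset V

namespace GDAG

variable {V : Type w} (G : GDAG V)

/-- The set `U` together with all children of nodes of `U`. -/
def inclusiveChildren (U : Set V) : Set V := {v | v ∈ U ∨ ∃ a ∈ U, G.edge a v}

/-- The set `U` together with all ancestors of nodes of `U`. -/
def inclusiveAncestors (U : Set V) : Set V := {v | ∃ a ∈ U, Relation.ReflTransGen G.edge v a}

/-- `l` is a pseudo-path relative to `W`: it avoids `W`, and consecutive nodes are adjacent, or have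
a common child, outside `W`. -/
def IsPseudoPath (W : Set V) (l : List V) : Prop :=
  (∀ v ∈ l, v ∉ W) ∧
    l.IsChain (fun a b => ¬ (G.inclusiveChildren {a} ∩ G.inclusiveChildren {b} ⊆ W))

/-- `X` and `Y` are d-separated by `Z`: every pseudo-path from `X` to `Y`, relative to the
complement of the inclusive past of `X ∪ Y ∪ Z`, meets `Z`. -/
def DSep (X Y Z : Set V) : Prop :=
  ∀ a ∈ X, ∀ b ∈ Y, ∀ l : List V, G.IsPseudoPath (G.inclusiveAncestors (X ∪ Y ∪ Z))ᶜ l →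
    l.head? = some a → l.getLast? = some b → ∃ v ∈ l, v ∈ Z

/-! ### Wires -/

/-- The unobserved edges, i.e. those that begin on an unobserved node. -/
def UEdge : Type w := {e : V × V // G.edge e.1 e.2 ∧ e.1 ∉ G.observed}

instance [Finite V] : Finite G.UEdge := by unfold UEdge; infer_instance

/-- The unobserved edges into `v`, listed in some order. -/
noncomputable def inWires [Finite V] (v : V) : List G.UEdge :=
  (Set.toFinite {e : G.UEdge | e.1.2 = v}).toFinset.toList

/-- The unobserved edges out of `v`, listed in some order (none if `v` is observed). -/
noncomputable def outWires [Finite V] (v : V) : List G.UEdge :=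
  (Set.toFinite {e : G.UEdge | e.1.1 = v}).toFinset.toList

/-- The outcome set of the node `v`: it is `Ω v` if `v` is observed, and has exactly one element if
`v` is unobserved. -/
abbrev Outcome (Ω : G.observed → Type) (v : V) : Type := ∀ h : v ∈ G.observed, Ω ⟨v, h⟩

/-- Values for the observed parents of `v`. -/
abbrev ParentValue (Ω : G.observed → Type) (v : V) : Type w :=
  ∀ j : {j : G.observed // G.edge j v}, Ω j.1

end GDAG

/-! ### Circuits -/

section Circuits

variable {C : Type (u + 1)} [LargeCategory C] [MonoidalCategory C] {E : Type w}

/-- The composite of the systems carried by a list of wires. -/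
def composite (sys : E → C) : List E → C
  | [] => 𝟙_ C
  | e :: L => sys e ⊗ composite sys L

/-- The composite of a concatenation is the composite of the two composites. -/
def compositeAppend (sys : E → C) (R : List E) :
    ∀ L : List E, composite sys (L ++ R) ≅ composite sys L ⊗ composite sys R
  | [] => (λ_ (composite sys R)).symm
  | e :: L => whiskerLeftIso (sys e) (compositeAppend sys R L) ≪≫
      (α_ (sys e) (composite sys L) (composite sys R)).symm

/-- `Rewiring sys L L' σ`: the morphism `σ` permutes the wires `L` into the order `L'` by crossing
adjacent wires. -/
inductive Rewiring [SymmetricCategory C] (sys : E → C) :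
    ∀ L L' : List E, (composite sys L ⟶ composite sys L') → Prop
  | nil : Rewiring sys [] [] (𝟙 _)
  | cons (e : E) {L L' : List E} {σ : composite sys L ⟶ composite sys L'} :
      Rewiring sys L L' σ → Rewiring sys (e :: L) (e :: L') (sys e ◁ σ)
  | swap (e e' : E) (L : List E) :
      Rewiring sys (e :: e' :: L) (e' :: e :: L)
        ((α_ (sys e) (sys e') (composite sys L)).inv ≫
          (β_ (sys e) (sys e')).hom ▷ composite sys L ≫
          (α_ (sys e') (sys e) (composite sys L)).hom)
  | trans {L L' L'' : List E} {σ : composite sys L ⟶ composite sys L'}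
      {τ : composite sys L' ⟶ composite sys L''} :
      Rewiring sys L L' σ → Rewiring sys L' L'' τ → Rewiring sys L L'' (σ ≫ τ)

end Circuits

/-! ### The generalised Markov condition -/

/-- An assignment, in the theory `T`, of a system to each unobserved edge of `G`, and to each node
`v` and each value of its observed parents of a test from the composite of the systems on the
incoming unobserved edges of `v` to the composite of those on its outgoing unobserved edges. Every
unobserved edge is a wire of its own, distinct from all others, and `sys` is the system it carries:
composition below matches wires by their edge, so two wires may carry copies of one system. -/
structure CircuitModel {C : Type (u + 1)} [LargeCategory C] [MonoidalCategory C]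
    [SymmetricCategory C] (T : CausalOPT C) {V : Type w} [Finite V] (G : GDAG V)
    (Ω : G.observed → Type) [∀ i, Finite (Ω i)] where
  sys : G.UEdge → C
  test : ∀ v : V, G.ParentValue Ω v → G.Outcome Ω v →
    (composite sys (G.inWires v) ⟶ composite sys (G.outWires v))
  isTest : ∀ (v : V) (c : G.ParentValue Ω v), T.IsTest (test v c)

namespace CircuitModel

variable {C : Type (u + 1)} [LargeCategory C] [MonoidalCategory C] [SymmetricCategory C]
  {T : CausalOPT C} {V : Type w} [Fintype V] [DecidableEq V] {G : GDAG V} {Ω : G.observed → Type}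
  [∀ i, Finite (Ω i)] (M : CircuitModel T G Ω)

/-- The event at node `v` when the observed variables take the values `x`. -/
def event (x : ∀ i, Ω i) (v : V) :
    composite M.sys (G.inWires v) ⟶ composite M.sys (G.outWires v) :=
  M.test v (fun j => x j.1) (fun h => x ⟨v, h⟩)

/-- `M.Partial S L f`: composing the events of the nodes in `S`, in causal order, yields for each
value `x` of the observed variables the event `f x`, with the open output wires `L`.
Wires are matched by the edge they belong to; as `C` is symmetric monoidal, the result does not
depend on the order in which the nodes are composed nor on how the wires are crossed. -/
inductive Partial : Finset V → ∀ L : List G.UEdge,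
    ((∀ i, Ω i) → (𝟙_ C ⟶ composite M.sys L)) → Prop
  | empty : Partial ∅ [] (fun _ => 𝟙 _)
  | rewire {S : Finset V} {L L' : List G.UEdge} {f : (∀ i, Ω i) → (𝟙_ C ⟶ composite M.sys L)}
      {σ : composite M.sys L ⟶ composite M.sys L'} :
      Partial S L f → Rewiring M.sys L L' σ → Partial S L' (fun x => f x ≫ σ)
  | node {S : Finset V} (v : V) {R : List G.UEdge}
      {f : (∀ i, Ω i) → (𝟙_ C ⟶ composite M.sys (G.inWires v ++ R))} :
      v ∉ S → (∀ a, G.edge a v → a ∈ S) → Partial S (G.inWires v ++ R) f →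
      Partial (insert v S) (G.outWires v ++ R) (fun x =>
        f x ≫ (compositeAppend M.sys R (G.inWires v)).hom ≫
          M.event x v ▷ composite M.sys R ≫
          (compositeAppend M.sys R (G.outWires v)).inv)

/-- The closed circuit formed by the events of all nodes has, for each value `x` of the observed
variables, probability `P x`. -/
def Realises (P : (∀ i, Ω i) → ℝ) : Prop :=
  ∃ f : (∀ i, Ω i) → (𝟙_ C ⟶ 𝟙_ C),
    M.Partial Finset.univ [] f ∧ ∀ x, P x = T.prob (f x)

end CircuitModel

/-- `P` is generalised Markov with respect to `G`: some causal operational-probabilistic theory has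
systems for the unobserved edges and tests for the nodes whose circuit has probabilities `P`. -/
def GDAG.IsGeneralisedMarkov {V : Type w} [Fintype V] [DecidableEq V] (G : GDAG V)
    {Ω : G.observed → Type} [∀ i, Finite (Ω i)] (P : (∀ i, Ω i) → ℝ) : Prop :=
  ∃ (C : Type (u + 1)) (_ : LargeCategory C) (_ : MonoidalCategory C) (_ : SymmetricCategory C)
    (T : CausalOPT C) (M : CircuitModel T G Ω), M.Realises P

/-! ### Conditional independence -/

section CondIndep

variable {V : Type w} [DecidableEq V] {O : Finset V} {Ω : O → Type} [∀ i, Fintype (Ω i)]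

open Classical in
/-- The marginal probability that the variables in `S` take the values that they have in `a`. -/
noncomputable def marginal (P : (∀ i, Ω i) → ℝ) (S : Set V) (a : ∀ i, Ω i) : ℝ :=
  ∑ x : (∀ i, Ω i) with ∀ i : O, (i : V) ∈ S → x i = a i, P x

/-- `P(x, y | z) = P(x | z) P(y | z)` for all values `x, y, z` of `X`, `Y`, `Z` with `P(z) ≠ 0`. -/
def CondIndepSets (P : (∀ i, Ω i) → ℝ) (X Y Z : Set V) : Prop :=
  ∀ a : ∀ i, Ω i, marginal P Z a ≠ 0 →
    marginal P (X ∪ Y ∪ Z) a / marginal P Z a =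
      (marginal P (X ∪ Z) a / marginal P Z a) * (marginal P (Y ∪ Z) a / marginal P Z a)

end CondIndep

/-! ### Whiskering and composites of wires. -/

section Whiskering

variable {C : Type (u + 1)} [LargeCategory C] [MonoidalCategory C] {E : Type w} (sys : E → C)

/-! Soundness. By causality, a node without children in the circuit can be summed out and its inputs
discarded. Hence the marginal on an ancestral set of nodes is the probability of the circuit of
these nodes alone with its open wires discarded (`Realises.exists_subcircuit`). Inside the ancestors
of `X ∪ Y ∪ Z`, let `D` be what pseudo-paths off `Z` reach from `X`. A node and its parents have a
common inclusive child, so those of them outside `Z` lie all in `D` or all outside it. Nodes of `Z`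
are observed, so no unobserved edge starts there, and the circuit falls into two pieces that share
no wire (`Subcircuit.exists_split`). Their weights multiply (`IsEvent.weight_applyFront`). One
depends only on values in `D ∪ Z`, the other not on values in `D`, and such a factorisation yields
conditional independence (`condIndepSets_of_factor`).

Splitting a circuit means reordering its nodes. This rests on coherence: a rewiring of distinct
wires is determined by its two ends (`Rewiring.unique`), so events on disjoint wires can be slid
past each other (`Subcircuit.exists_last`).

Completeness. If d-separation fails, a zigzag chain of nodes links a node feeding `X` to a node
feeding `Y`, consecutive ones feeding a common node of `Z` (`exists_chain_of_not_dSep`). In a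
classical model (`feedModel`) every node draws a fair bit; nodes outside `Z` pass on the set of bits
that reach them, and nodes of `Z` only tell whether both bits arrive. If no node of `Z` sees both,
the bits along the chain agree. So `X` seeing only `false` and `Y` seeing only `true` has
conditional probability zero, while each alone has positive probability, as constant bits show. Only
supports of matrices have to be computed. -/

theorem whiskerLeft_comp_appendIso (A : C) {B D D' F F' : C} {c : F ≅ B ⊗ D} {c' : F' ≅ B ⊗ D'}
    {t : D ⟶ D'} {s : F ⟶ F'} (h : s ≫ c'.hom = c.hom ≫ B ◁ t) :
    A ◁ s ≫ (whiskerLeftIso A c' ≪≫ (α_ A B D').symm).hom =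
      (whiskerLeftIso A c ≪≫ (α_ A B D).symm).hom ≫ (A ⊗ B) ◁ t := by
  simp only [Iso.trans_hom, whiskerLeftIso_hom, Iso.symm_hom, Category.assoc]
  rw [← associator_inv_naturality_right, ← whiskerLeft_comp_assoc, ← whiskerLeft_comp_assoc, h]

theorem leftUnitor_inv_comp_rightUnitor :
    (λ_ (𝟙_ C)).symm.hom ≫ (ρ_ (𝟙_ C)).hom = 𝟙 _ := by
  rw [← unitors_equal]
  simp

theorem appendIso_comp_rightUnitor (A : C) {B F : C} (c : F ≅ B ⊗ 𝟙_ C) :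
    (whiskerLeftIso A c ≪≫ (α_ A B (𝟙_ C)).symm).hom ≫ (ρ_ (A ⊗ B)).hom =
      A ◁ (c.hom ≫ (ρ_ B).hom) := by
  simp

/-- A morphism of composites, with one further wire `e` in front. -/
def consWire (e : E) {L L' : List E} (t : composite sys L ⟶ composite sys L') :
    composite sys (e :: L) ⟶ composite sys (e :: L') :=
  sys e ◁ t

variable {sys}

theorem consWire_id (e : E) (L : List E) : consWire sys e (𝟙 (composite sys L)) = 𝟙 _ :=
  whiskerLeft_id _ _

theorem consWire_comp (e : E) {L L' L'' : List E} (s : composite sys L ⟶ composite sys L')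
    (t : composite sys L' ⟶ composite sys L'') :
    consWire sys e (s ≫ t) = consWire sys e s ≫ consWire sys e t :=
  whiskerLeft_comp _ _ _

end Whiskering

/-! ### Crossing one system past others. -/

section Crossing

variable {C : Type (u + 1)} [LargeCategory C] [MonoidalCategory C] [SymmetricCategory C]

/-- The morphism that crosses the first two of three systems. -/
def crossing (A B D : C) : A ⊗ B ⊗ D ⟶ B ⊗ A ⊗ D :=
  (α_ A B D).inv ≫ (β_ A B).hom ▷ D ≫ (α_ B A D).hom

theorem crossing_crossing (A B D : C) : crossing A B D ≫ crossing B A D = 𝟙 _ := by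
  simp [crossing, ← comp_whiskerRight_assoc]

theorem crossing_naturality (A B : C) {D D' : C} (t : D ⟶ D') :
    crossing A B D ≫ B ◁ A ◁ t = A ◁ B ◁ t ≫ crossing A B D' := by
  simp only [crossing, Category.assoc]
  rw [associator_inv_naturality_right_assoc, whisker_exchange_assoc,
    associator_naturality_right]

theorem crossing_naturality_middle (A : C) {B B' : C} (k : B ⟶ B') (D : C) :
    crossing A B D ≫ k ▷ (A ⊗ D) = A ◁ (k ▷ D) ≫ crossing A B' D := by
  simp only [crossing, Category.assoc]
  rw [← associator_naturality_left, ← comp_whiskerRight_assoc,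
    ← BraidedCategory.braiding_naturality_right,
    associator_inv_naturality_middle_assoc, comp_whiskerRight_assoc]

/-- Up to associators this is the Yang–Baxter equation for `A`, `B`, `D`, with `F` as a spectator.
-/
theorem crossing_yang_baxter (A B D F : C) :
    crossing A B (D ⊗ F) ≫ B ◁ crossing A D F ≫ crossing B D (A ⊗ F) =
      A ◁ crossing B D F ≫ crossing A D (B ⊗ F) ≫ D ◁ crossing A B F := by
  calc
    _ = 𝟙 _ ⊗≫ ((α_ A B D).inv ≫ (β_ A B).hom ▷ D ≫ (α_ B A D).hom ≫ B ◁ (β_ A D).hom ≫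
          (α_ B D A).inv ≫ (β_ B D).hom ▷ A ≫ (α_ D B A).hom) ▷ F ⊗≫ 𝟙 _ := by
      simp only [crossing]
      monoidal
    _ = _ := by
      rw [BraidedCategory.yang_baxter]
      simp only [crossing]
      monoidal

theorem crossing_tensor (A B B' D : C) :
    crossing A (B ⊗ B') D = A ◁ (α_ B B' D).hom ≫ crossing A B (B' ⊗ D) ≫
      B ◁ crossing A B' D ≫ (α_ B B' (A ⊗ D)).inv := by
  simp only [crossing, BraidedCategory.braiding_tensor_right_hom]
  monoidal

theorem crossing_unit (A D : C) :
    crossing A (𝟙_ C) D = A ◁ (λ_ D).hom ≫ (λ_ (A ⊗ D)).inv := by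
  simp only [crossing, braiding_tensorUnit_right]
  monoidal

theorem crossing_conj_unit (A D : C) :
    A ◁ (λ_ D).symm.hom ≫ crossing A (𝟙_ C) D ≫ (λ_ (A ⊗ D)).symm.inv = 𝟙 _ := by
  simp [crossing_unit]

/-- The hexagon identity: a block is crossed one factor at a time. This is the inductive step of
`Rewiring.moveWire`, with arbitrary isomorphisms in place of `compositeAppend`. -/
theorem crossing_conj_appendIso (A A' : C) {B D F F' : C} (c : F ≅ B ⊗ D)
    (c' : F' ≅ B ⊗ A ⊗ D) :
    A ◁ (whiskerLeftIso A' c ≪≫ (α_ A' B D).symm).hom ≫ crossing A (A' ⊗ B) D ≫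
      (whiskerLeftIso A' c' ≪≫ (α_ A' B (A ⊗ D)).symm).inv =
      crossing A A' F ≫ A' ◁ (A ◁ c.hom ≫ crossing A B D ≫ c'.inv) := by
  have h := crossing_naturality A A' c.hom
  simp only [crossing_tensor, Iso.symm_hom, Iso.symm_inv, Iso.trans_hom, Iso.trans_inv,
    whiskerLeftIso_hom, whiskerLeftIso_inv, MonoidalCategory.whiskerLeft_comp, Category.assoc,
    Iso.inv_hom_id_assoc, whiskerLeft_inv_hom_assoc, reassoc_of% h]

theorem crossing_conj_naturality (A : C) {B B' D F F' H H' : C} (k : B ⟶ B') (c : F ≅ B ⊗ D)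
    (c' : F' ≅ B' ⊗ D) (d : H ≅ B ⊗ A ⊗ D) (d' : H' ≅ B' ⊗ A ⊗ D) :
    (A ◁ c.hom ≫ crossing A B D ≫ d.inv) ≫ d.hom ≫ k ▷ (A ⊗ D) ≫ d'.inv =
      A ◁ (c.hom ≫ k ▷ D ≫ c'.inv) ≫ A ◁ c'.hom ≫ crossing A B' D ≫ d'.inv := by
  have h := crossing_naturality_middle A k D
  simp only [MonoidalCategory.whiskerLeft_comp, Category.assoc, Iso.inv_hom_id_assoc,
    whiskerLeft_inv_hom_assoc, reassoc_of% h]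

end Crossing

/-! ### Coherence: rewirings of distinct wires are unique. -/

section Rewiring

variable {C : Type (u + 1)} [LargeCategory C] [MonoidalCategory C] [SymmetricCategory C]
  {E : Type w} (sys : E → C)

/-- The morphism of composites that crosses the first two wires. -/
def crossWires (e e' : E) (L : List E) :
    composite sys (e :: e' :: L) ⟶ composite sys (e' :: e :: L) :=
  crossing (sys e) (sys e') (composite sys L)

variable {sys}

theorem crossWires_crossWires (e e' : E) (L : List E) :
    crossWires sys e e' L ≫ crossWires sys e' e L = 𝟙 _ :=
  crossing_crossing _ _ _

theorem crossWires_naturality (e e' : E) {L L' : List E}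
    (t : composite sys L ⟶ composite sys L') :
    crossWires sys e e' L ≫ consWire sys e' (consWire sys e t) =
      consWire sys e (consWire sys e' t) ≫ crossWires sys e e' L' :=
  crossing_naturality _ _ t

theorem crossWires_yang_baxter (a b d : E) (L : List E) :
    crossWires sys a b (d :: L) ≫ consWire sys b (crossWires sys a d L) ≫
      crossWires sys b d (a :: L) =
      consWire sys a (crossWires sys b d L) ≫ crossWires sys a d (b :: L) ≫
        consWire sys d (crossWires sys a b L) :=
  crossing_yang_baxter _ _ _ _

namespace Rewiring

theorem refl : ∀ L : List E, Rewiring sys L L (𝟙 _)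
  | [] => .nil
  | e :: L => by
    have h := (refl L).cons e
    rwa [whiskerLeft_id] at h

theorem congr {L L' : List E} {σ σ' : composite sys L ⟶ composite sys L'}
    (h : Rewiring sys L L' σ) (e : σ' = σ) : Rewiring sys L L' σ' :=
  e ▸ h

theorem perm {L L' : List E} {σ : composite sys L ⟶ composite sys L'} (h : Rewiring sys L L' σ) :
    L.Perm L' := by
  induction h with
  | nil => exact .nil
  | cons e _ ih => exact ih.cons e
  | swap e e' L => exact .swap _ _ _
  | trans _ _ ih ih' => exact ih.trans ih'

theorem exists_of_perm {L L' : List E} (h : L.Perm L') :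
    ∃ σ : composite sys L ⟶ composite sys L', Rewiring sys L L' σ := by
  induction h with
  | nil => exact ⟨_, .nil⟩
  | cons e _ ih => exact ih.elim fun _ h => ⟨_, h.cons e⟩
  | swap e e' L => exact ⟨_, .swap _ _ _⟩
  | trans _ _ ih ih' => exact ih.elim fun _ h => ih'.elim fun _ h' => ⟨_, h.trans h'⟩

theorem exists_inverse {L L' : List E} {σ : composite sys L ⟶ composite sys L'}
    (h : Rewiring sys L L' σ) : ∃ τ, Rewiring sys L' L τ ∧ σ ≫ τ = 𝟙 _ := by
  induction h with
  | nil => exact ⟨_, .nil, by simp⟩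
  | cons e _ ih =>
    obtain ⟨τ, h, hτ⟩ := ih
    exact ⟨_, h.cons e, (consWire_comp e _ _).symm.trans (by rw [hτ, consWire_id])⟩
  | swap e e' L => exact ⟨_, .swap _ _ _, crossWires_crossWires e e' L⟩
  | trans _ _ ih ih' =>
    obtain ⟨τ, h, hτ⟩ := ih
    obtain ⟨τ', h', hτ'⟩ := ih'
    exact ⟨_, h'.trans h, by rw [Category.assoc, reassoc_of% hτ', hτ]⟩

end Rewiring

/-- `PullOut sys e L L₀ τ`: the morphism `τ` moves the first occurrence of the wire `e` in `L` to
the front, which leaves `L₀` behind. -/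
inductive PullOut (sys : E → C) (e : E) :
    ∀ L L₀ : List E, (composite sys L ⟶ composite sys (e :: L₀)) → Prop
  | head (L : List E) : PullOut sys e (e :: L) L (𝟙 _)
  | cons {f : E} (hf : f ≠ e) {L L₀ : List E} {τ : composite sys L ⟶ composite sys (e :: L₀)} :
      PullOut sys e L L₀ τ →
      PullOut sys e (f :: L) (f :: L₀) (consWire sys f τ ≫ crossWires sys f e L₀)

theorem PullOut.exists_of_mem {e : E} {L : List E} (h : e ∈ L) :
    ∃ L₀ τ, PullOut sys e L L₀ τ := by
  induction L with
  | nil => cases h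
  | cons f L ih =>
    by_cases hf : f = e
    · subst hf
      exact ⟨_, _, .head L⟩
    · obtain ⟨L₀, τ, hτ⟩ := ih ((List.mem_cons.1 h).resolve_left (Ne.symm hf))
      exact ⟨_, _, .cons hf hτ⟩

/-- Moving `e` to the front commutes with a rewiring, up to a rewiring of the wires left behind. It
suffices to check one adjacent crossing, where the relations needed are involutivity, naturality and
Yang–Baxter. -/
theorem Rewiring.pullOut {e : E} {L L' : List E} {σ : composite sys L ⟶ composite sys L'}
    (h : Rewiring sys L L' σ) (hL : L.Nodup) {L₀ : List E}
    {τ : composite sys L ⟶ composite sys (e :: L₀)} (hτ : PullOut sys e L L₀ τ) :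
    ∃ L₀' τ' σ', PullOut sys e L' L₀' τ' ∧ Rewiring sys L₀ L₀' σ' ∧
      σ ≫ τ' = τ ≫ consWire sys e σ' := by
  induction h generalizing L₀ with
  | nil => cases hτ
  | @cons f L L' σ h ih =>
    cases hτ with
    | head => exact ⟨_, _, _, .head _, h, (Category.comp_id _).trans (Category.id_comp _).symm⟩
    | @cons _ hf _ L₀ τ hτ =>
      obtain ⟨L₀', τ', σ', h1, h2, h3⟩ := ih hL.of_cons hτ
      refine ⟨_, _, _, .cons hf h1, h2.cons f, ?_⟩
      change consWire sys f σ ≫ _ = _ ≫ consWire sys e (consWire sys f σ')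
      rw [← Category.assoc, ← consWire_comp, h3, consWire_comp, Category.assoc, Category.assoc,
        crossWires_naturality]
  | swap f f' L =>
    change ∃ L₀' τ' σ', PullOut sys e _ L₀' τ' ∧ Rewiring sys L₀ L₀' σ' ∧
      crossWires sys f f' L ≫ τ' = τ ≫ consWire sys e σ'
    -- Two wires with the same label would break the claim: crossing them is not the identity, yet
    -- the first occurrence of `e` stays the first.
    have hne : f ≠ f' := by
      rintro rfl
      simp at hL
    cases hτ with
    | head =>
      refine ⟨_, _, _, .cons hne.symm (.head _), .refl _, ?_⟩
      rw [consWire_id, consWire_id, Category.id_comp, Category.id_comp, crossWires_crossWires]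
    | @cons _ hf _ L₀ τ hτ =>
      cases hτ with
      | head =>
        refine ⟨_, _, _, .head _, .refl _, ?_⟩
        rw [consWire_id, consWire_id]
        simp
      | @cons _ hf' _ L₀ τ hτ =>
        -- Here `e` lies behind both crossed wires and has to pass each of them: the Yang–Baxter
        -- case.
        refine ⟨_, _, _, .cons hf' (.cons hf hτ), Rewiring.swap f f' L₀, ?_⟩
        change _ = _ ≫ consWire sys e (crossWires sys f f' L₀)
        simp only [consWire_comp, Category.assoc]
        rw [← crossWires_yang_baxter, ← Category.assoc, crossWires_naturality, Category.assoc]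
  | trans h h' ih ih' =>
    obtain ⟨L₀', τ', σ', h1, h2, h3⟩ := ih hL hτ
    obtain ⟨L₀'', τ'', σ'', h1', h2', h3'⟩ := ih' (h.perm.nodup_iff.1 hL) h1
    refine ⟨_, _, _, h1', h2.trans h2', ?_⟩
    rw [consWire_comp, Category.assoc, h3', reassoc_of% h3]

/-- The equality is heterogeneous because the final list is empty only propositionally, by
`Rewiring.perm`. -/
theorem Rewiring.heq_id {L L' : List E} {σ : composite sys L ⟶ composite sys L'}
    (h : Rewiring sys L L' σ) (hL : L = []) : HEq σ (𝟙 (𝟙_ C)) := by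
  induction h with
  | nil => rfl
  | cons => cases hL
  | swap => cases hL
  | trans h h' ih ih' =>
    subst hL
    obtain rfl := List.nil_perm.1 h.perm
    obtain rfl := List.nil_perm.1 h'.perm
    have e := eq_of_heq (ih rfl)
    have e' := eq_of_heq (ih' rfl)
    rw [e, e']
    exact heq_of_eq (Category.comp_id _)

/-- A rewiring of distinct wires is determined by their initial and final order. -/
theorem Rewiring.unique {L L' : List E} {σ ρ : composite sys L ⟶ composite sys L'}
    (hσ : Rewiring sys L L' σ) (hρ : Rewiring sys L L' ρ) (hL : L.Nodup) : σ = ρ := by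
  induction L' generalizing L with
  | nil =>
    obtain rfl := List.perm_nil.1 hσ.perm
    exact (eq_of_heq (hσ.heq_id rfl)).trans (eq_of_heq (hρ.heq_id rfl)).symm
  | cons e T ih =>
    -- In the final order `e` is already in front, so pulling it out there is the identity. Both
    -- rewirings therefore equal `τ` followed by a rewiring of the remaining wires, to which the
    -- induction hypothesis applies.
    obtain ⟨L₀, τ, hτ⟩ := PullOut.exists_of_mem (sys := sys) (hσ.perm.mem_iff.2 List.mem_cons_self)
    obtain ⟨_, _, σ', h1, h2, h3⟩ := hσ.pullOut hL hτ
    obtain ⟨_, _, ρ', h1', h2', h3'⟩ := hρ.pullOut hL hτ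
    cases h1 with
    | cons hf => exact absurd rfl hf
    | head =>
      cases h1' with
      | cons hf => exact absurd rfl hf
      | head =>
        have hL₀ : L₀.Nodup := by
          have := (hσ.perm.nodup_iff.1 hL).of_cons
          exact h2.perm.nodup_iff.2 this
        rw [Category.comp_id] at h3 h3'
        rw [h3, h3', ih h2 h2' hL₀]

end Rewiring

/-! ### Events acting on blocks of wires. -/

section Blocks

variable {C : Type (u + 1)} [LargeCategory C] [MonoidalCategory C] {E : Type w} {sys : E → C}

/-- A morphism between composites applied to the first wires of a longer list. -/
def applyFront {A B : List E} (h : composite sys A ⟶ composite sys B) (R : List E) :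
    composite sys (A ++ R) ⟶ composite sys (B ++ R) :=
  (compositeAppend sys R A).hom ≫ h ▷ composite sys R ≫ (compositeAppend sys R B).inv

/-- A morphism between composites applied behind the wires of `A`. -/
def applyBehind : ∀ (A : List E) {R R' : List E} (_ : composite sys R ⟶ composite sys R'),
    composite sys (A ++ R) ⟶ composite sys (A ++ R')
  | [], _, _, t => t
  | e :: A, _, _, t => consWire sys e (applyBehind A t)

theorem applyBehind_compositeAppend (A : List E) {R R' : List E}
    (t : composite sys R ⟶ composite sys R') :
    applyBehind A t ≫ (compositeAppend sys R' A).hom =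
      (compositeAppend sys R A).hom ≫ composite sys A ◁ t := by
  induction A with
  | nil => exact (leftUnitor_inv_naturality t)
  | cons e A ih => exact whiskerLeft_comp_appendIso (sys e) ih

/-- The interchange law: morphisms on disjoint blocks of wires commute. -/
theorem applyFront_applyBehind {A B : List E} (h : composite sys A ⟶ composite sys B)
    {R R' : List E} (t : composite sys R ⟶ composite sys R') :
    applyFront h R ≫ applyBehind B t = applyBehind A t ≫ applyFront h R' := by
  rw [← cancel_mono (compositeAppend sys R' B).hom]
  simp only [applyFront, Category.assoc, applyBehind_compositeAppend, Iso.inv_hom_id_assoc,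
    Iso.inv_hom_id, Category.comp_id]
  rw [← whisker_exchange, ← Category.assoc (applyBehind A t), applyBehind_compositeAppend,
    Category.assoc]

theorem prepare_comp_rightUnitor {A F : C} (s : 𝟙_ C ⟶ A) (c : F ≅ A ⊗ 𝟙_ C) :
    𝟙 _ ≫ ((λ_ (𝟙_ C)).symm.hom ≫ s ▷ 𝟙_ C ≫ c.inv) ≫ c.hom ≫ (ρ_ A).hom = s := by
  simp only [Category.assoc, Iso.inv_hom_id_assoc, Iso.symm_hom]
  rw [rightUnitor_naturality, ← unitors_equal]
  simp

theorem prepare_applyFront_nil {L : List E} (s : 𝟙_ C ⟶ composite sys L) :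
    𝟙 _ ≫ applyFront (A := []) s [] ≫ (compositeAppend sys [] L).hom ≫
      (ρ_ (composite sys L)).hom = s :=
  prepare_comp_rightUnitor s (compositeAppend sys [] L)

/-- Two parallel preparations that are both discarded form a product of two scalars; this is what
makes the weights of separate circuits multiply. -/
theorem prepare_whiskerRight_discard {A B : C} (r : 𝟙_ C ⟶ A) (s : 𝟙_ C ⟶ B) (d : A ⟶ 𝟙_ C)
    (d' : B ⟶ 𝟙_ C) :
    r ≫ (λ_ A).inv ≫ s ▷ A ≫ (d' ⊗ₘ d) ≫ (λ_ (𝟙_ C)).hom = (r ≫ d) ≫ s ≫ d' := by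
  have h : s ▷ A ≫ (d' ⊗ₘ d) = 𝟙_ C ◁ d ≫ (s ≫ d') ▷ 𝟙_ C := by
    rw [tensorHom_def', ← whisker_exchange_assoc, comp_whiskerRight]
  rw [reassoc_of% h, ← leftUnitor_inv_naturality_assoc, unitors_equal, rightUnitor_naturality,
    ← unitors_equal]
  simp

variable [SymmetricCategory C]

theorem Rewiring.applyBehind (A : List E) {R R' : List E} {t : composite sys R ⟶ composite sys R'}
    (h : Rewiring sys R R' t) : Rewiring sys (A ++ R) (A ++ R') (applyBehind A t) := by
  induction A with
  | nil => exact h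
  | cons e A ih => exact ih.cons e

/-- The wire `e` moved behind the wires of `B`. -/
def moveWire (e : E) (B R : List E) :
    composite sys (e :: (B ++ R)) ⟶ composite sys (B ++ e :: R) :=
  sys e ◁ (compositeAppend sys R B).hom ≫ crossing (sys e) (composite sys B) (composite sys R) ≫
    (compositeAppend sys (e :: R) B).inv

theorem Rewiring.moveWire (e : E) (B R : List E) :
    Rewiring sys (e :: (B ++ R)) (B ++ e :: R) (moveWire e B R) := by
  induction B with
  | nil =>
    exact (Rewiring.refl (e :: R)).congr (crossing_conj_unit (sys e) (composite sys R))
  | cons b B ih =>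
    exact ((Rewiring.swap e b (B ++ R)).trans (ih.cons b)).congr
      (crossing_conj_appendIso (sys e) (sys b) (compositeAppend sys R B)
        (compositeAppend sys (e :: R) B))

theorem moveWire_applyFront (e : E) {B B₁ : List E} (k : composite sys B ⟶ composite sys B₁)
    (R : List E) :
    moveWire e B R ≫ applyFront k (e :: R) = consWire sys e (applyFront k R) ≫ moveWire e B₁ R :=
  crossing_conj_naturality (sys e) k (compositeAppend sys R B) (compositeAppend sys R B₁)
    (compositeAppend sys (e :: R) B) (compositeAppend sys (e :: R) B₁)

/-- The wires of `A` moved behind those of `B`. -/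
def moveBlock : ∀ A B R : List E, composite sys (A ++ (B ++ R)) ⟶ composite sys (B ++ (A ++ R))
  | [], _, _ => 𝟙 _
  | e :: A, B, R => consWire sys e (moveBlock A B R) ≫ moveWire e B (A ++ R)

theorem Rewiring.moveBlock (A B R : List E) :
    Rewiring sys (A ++ (B ++ R)) (B ++ (A ++ R)) (moveBlock A B R) := by
  induction A with
  | nil => exact .refl _
  | cons e A ih => exact (ih.cons e).trans (.moveWire e B (A ++ R))

/-- Naturality of the symmetry: it does not matter whether a morphism acts before or after its wires
are brought to the front. -/
theorem moveBlock_applyFront (A : List E) {B B' : List E}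
    (k : composite sys B ⟶ composite sys B') (R : List E) :
    moveBlock A B R ≫ applyFront k (A ++ R) =
      applyBehind A (applyFront k R) ≫ moveBlock A B' R := by
  induction A with
  | nil => simp [moveBlock, applyBehind]
  | cons e A ih =>
    change (consWire sys e (moveBlock A B R) ≫ moveWire e B (A ++ R)) ≫
        applyFront k (e :: (A ++ R)) =
      consWire sys e (applyBehind A (applyFront k R)) ≫
        consWire sys e (moveBlock A B' R) ≫ moveWire e B' (A ++ R)
    rw [Category.assoc, moveWire_applyFront, ← Category.assoc, ← consWire_comp, ih, consWire_comp,
      Category.assoc]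

theorem Rewiring.appendNil (L : List E) :
    Rewiring sys (L ++ []) L ((compositeAppend sys [] L).hom ≫ (ρ_ (composite sys L)).hom) := by
  induction L with
  | nil => exact Rewiring.nil.congr (leftUnitor_inv_comp_rightUnitor (C := C))
  | cons e L ih =>
    exact (ih.cons e).congr (appendIso_comp_rightUnitor (sys e) (compositeAppend sys [] L))

end Blocks

theorem List.Nodup.exists_perm_append {α : Type*} {A R : List α} (hA : A.Nodup) (h : A ⊆ R) :
    ∃ R', R.Perm (A ++ R') := by
  classical
  exact ⟨R.diff A, (List.subperm_append_diff_self_of_count_le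
    (List.subperm_ext_iff.1 (hA.subperm h))).symm⟩

/-! ### Tests, discarding and the consequences of causality. -/

namespace CausalOPT

variable {C : Type (u + 1)} [LargeCategory C] [MonoidalCategory C] [SymmetricCategory C]
  (T : CausalOPT C)

/-- A family of events that is a test up to a relabelling of the outcomes. -/
def IsTestUpTo {X : Type*} {A B : C} (t : X → (A ⟶ B)) : Prop :=
  ∃ (Y : Type) (_ : Finite Y) (φ : Y ≃ X), T.IsTest (fun y => t (φ y))

/-- A morphism that is the only member of a test, up to a relabelling of the outcome. -/
def IsDeterministic {A B : C} (e : A ⟶ B) : Prop := T.IsTestUpTo (fun _ : Unit => e)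

/-- A member of some test. -/
def IsEvent {A B : C} (r : A ⟶ B) : Prop :=
  ∃ (Y : Type) (_ : Finite Y) (t : Y → (A ⟶ B)), T.IsTest t ∧ ∃ y, t y = r

variable {T}

theorem IsTest.isTestUpTo {X : Type} [Finite X] {A B : C} {t : X → (A ⟶ B)} (ht : T.IsTest t) :
    T.IsTestUpTo t :=
  ⟨X, inferInstance, Equiv.refl X, ht⟩

namespace IsTestUpTo

variable {X Y : Type*} {A B D F : C}

theorem relabel {t : X → (A ⟶ B)} (ht : T.IsTestUpTo t) (φ : Y ≃ X) :
    T.IsTestUpTo (fun y => t (φ y)) := by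
  obtain ⟨Z, _, ψ, h⟩ := ht
  exact ⟨Z, inferInstance, ψ.trans φ.symm, by simpa using h⟩

theorem comp {s : X → (A ⟶ B)} {t : Y → (B ⟶ D)} (hs : T.IsTestUpTo s) (ht : T.IsTestUpTo t) :
    T.IsTestUpTo (fun p : X × Y => s p.1 ≫ t p.2) := by
  obtain ⟨Z, _, ψ, h⟩ := hs
  obtain ⟨Z', _, ψ', h'⟩ := ht
  exact ⟨Z × Z', inferInstance, ψ.prodCongr ψ', T.isTest_comp _ _ h h'⟩

theorem tensor {s : X → (A ⟶ B)} {t : Y → (D ⟶ F)} (hs : T.IsTestUpTo s) (ht : T.IsTestUpTo t) :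
    T.IsTestUpTo (fun p : X × Y => s p.1 ⊗ₘ t p.2) := by
  obtain ⟨Z, _, ψ, h⟩ := hs
  obtain ⟨Z', _, ψ', h'⟩ := ht
  exact ⟨Z × Z', inferInstance, ψ.prodCongr ψ', T.isTest_tensor _ _ h h'⟩

/-- Composition produces the outcome set `X × Unit`, and tests are not assumed closed under
relabelling; hence `IsTestUpTo`. -/
theorem comp_deterministic {s : X → (A ⟶ B)} {e : B ⟶ D} (hs : T.IsTestUpTo s)
    (he : T.IsDeterministic e) : T.IsTestUpTo (fun x => s x ≫ e) :=
  (hs.comp he).relabel (Equiv.prodPUnit X).symm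

theorem deterministic_comp {s : X → (B ⟶ D)} {e : A ⟶ B} (he : T.IsDeterministic e)
    (hs : T.IsTestUpTo s) : T.IsTestUpTo (fun x => e ≫ s x) :=
  (IsTestUpTo.comp he hs).relabel (Equiv.punitProd X).symm

theorem isEvent {t : X → (A ⟶ B)} (ht : T.IsTestUpTo t) (x : X) : T.IsEvent (t x) := by
  obtain ⟨Z, _, ψ, h⟩ := ht
  exact ⟨Z, inferInstance, _, h, ψ.symm x, by simp⟩

end IsTestUpTo

theorem isDeterministic_id (A : C) : T.IsDeterministic (𝟙 A) := (T.isTest_id A).isTestUpTo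

namespace IsDeterministic

variable {A B D F : C}

theorem isEvent {e : A ⟶ B} (he : T.IsDeterministic e) : T.IsEvent e := IsTestUpTo.isEvent he ()

theorem comp {e : A ⟶ B} {e' : B ⟶ D} (he : T.IsDeterministic e) (he' : T.IsDeterministic e') :
    T.IsDeterministic (e ≫ e') :=
  IsTestUpTo.comp_deterministic he he'

theorem tensor {e : A ⟶ B} {e' : D ⟶ F} (he : T.IsDeterministic e) (he' : T.IsDeterministic e') :
    T.IsDeterministic (e ⊗ₘ e') :=
  (IsTestUpTo.tensor he he').relabel (Equiv.prodPUnit Unit).symm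

theorem whiskerLeft {e : A ⟶ B} (he : T.IsDeterministic e) (D : C) :
    T.IsDeterministic (D ◁ e) := by
  simpa using (isDeterministic_id D).tensor he

theorem whiskerRight {e : A ⟶ B} (he : T.IsDeterministic e) (D : C) :
    T.IsDeterministic (e ▷ D) := by
  simpa using he.tensor (isDeterministic_id D)

end IsDeterministic

theorem IsTestUpTo.whiskerRight {X : Type*} {A B : C} {t : X → (A ⟶ B)} (ht : T.IsTestUpTo t)
    (D : C) : T.IsTestUpTo (fun x => t x ▷ D) := by
  simpa using (ht.tensor (isDeterministic_id D)).relabel (Equiv.prodPUnit X).symm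

theorem IsEvent.comp {A B D : C} {r : A ⟶ B} {s : B ⟶ D} (hr : T.IsEvent r) (hs : T.IsEvent s) :
    T.IsEvent (r ≫ s) := by
  obtain ⟨X, _, t, ht, x, rfl⟩ := hr
  obtain ⟨Y, _, t', ht', y, rfl⟩ := hs
  exact ⟨X × Y, inferInstance, _, T.isTest_comp _ _ ht ht', (x, y), rfl⟩

theorem IsEvent.prob_nonneg {r : 𝟙_ C ⟶ 𝟙_ C} (hr : T.IsEvent r) : 0 ≤ T.prob r := by
  obtain ⟨X, _, t, ht, x, rfl⟩ := hr
  have := Fintype.ofFinite X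
  exact (T.prob_test t ht).1 x

theorem IsEvent.prob_comp {r s : 𝟙_ C ⟶ 𝟙_ C} (hr : T.IsEvent r) (hs : T.IsEvent s) :
    T.prob (r ≫ s) = T.prob r * T.prob s := by
  obtain ⟨X, _, t, ht, x, rfl⟩ := hr
  obtain ⟨Y, _, t', ht', y, rfl⟩ := hs
  exact T.prob_comp t t' ht ht' x y

section Wires

variable {E : Type w} {sys : E → C}

theorem isDeterministic_compositeAppend_hom (R L : List E) :
    T.IsDeterministic (compositeAppend sys R L).hom := by
  induction L with
  | nil => exact (T.isTest_leftUnitor_inv _).isTestUpTo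
  | cons e L ih =>
    exact (ih.whiskerLeft (sys e)).comp (T.isTest_associator_inv _ _ _).isTestUpTo

theorem isDeterministic_compositeAppend_inv (R L : List E) :
    T.IsDeterministic (compositeAppend sys R L).inv := by
  induction L with
  | nil => exact (T.isTest_leftUnitor_hom _).isTestUpTo
  | cons e L ih =>
    exact IsDeterministic.comp (T.isTest_associator_hom _ _ _).isTestUpTo
      (ih.whiskerLeft (sys e))

theorem _root_.Rewiring.isDeterministic {L L' : List E} {σ : composite sys L ⟶ composite sys L'}
    (h : Rewiring sys L L' σ) : T.IsDeterministic σ := by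
  induction h with
  | nil => exact isDeterministic_id _
  | cons e _ ih => exact ih.whiskerLeft _
  | swap e e' L =>
    exact IsDeterministic.comp (T.isTest_associator_inv _ _ _).isTestUpTo
      (IsDeterministic.comp
        (IsDeterministic.whiskerRight (T.isTest_braiding _ _).isTestUpTo _)
        (T.isTest_associator_hom _ _ _).isTestUpTo)
  | trans _ _ ih ih' => exact ih.comp ih'

theorem IsTestUpTo.applyFront {X : Type*} {A B : List E}
    {t : X → (composite sys A ⟶ composite sys B)} (ht : T.IsTestUpTo t) (R : List E) :
    T.IsTestUpTo (fun x => applyFront (t x) R) :=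
  .deterministic_comp (isDeterministic_compositeAppend_hom R A)
    ((ht.whiskerRight _).comp_deterministic (isDeterministic_compositeAppend_inv R B))

theorem IsEvent.applyFront {A B : List E} {s : composite sys A ⟶ composite sys B}
    (hs : T.IsEvent s) (R : List E) : T.IsEvent (applyFront s R) := by
  obtain ⟨Y, _, t, ht, y, rfl⟩ := hs
  exact (ht.isTestUpTo.applyFront R).isEvent y

end Wires

variable (T)

/-- A deterministic effect. -/
noncomputable def discard (A : C) : A ⟶ 𝟙_ C := (T.exists_deterministic A).choose

/-- The probability of a preparation-event whose output is discarded. -/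
noncomputable def weight {A : C} (r : 𝟙_ C ⟶ A) : ℝ := T.prob (r ≫ T.discard A)

variable {T}

theorem isDeterministic_discard (A : C) : T.IsDeterministic (T.discard A) :=
  (T.exists_deterministic A).choose_spec.isTestUpTo

theorem IsEvent.sum_prob {X : Type*} [Fintype X] {A : C} {r : 𝟙_ C ⟶ A} (hr : T.IsEvent r)
    {a : X → (A ⟶ 𝟙_ C)} (ha : T.IsTestUpTo a) : ∑ x, T.prob (r ≫ a x) = T.weight r := by
  obtain ⟨Y, _, t, ht, y, rfl⟩ := hr
  obtain ⟨Z, _, φ, h⟩ := ha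
  have := Fintype.ofFinite Z
  rw [← φ.sum_comp]
  exact T.deterministic_unique _ _ t h (T.exists_deterministic A).choose_spec ht y

theorem IsEvent.prob_deterministic {A : C} {r : 𝟙_ C ⟶ A} (hr : T.IsEvent r) {e : A ⟶ 𝟙_ C}
    (he : T.IsDeterministic e) : T.prob (r ≫ e) = T.weight r := by
  simpa using hr.sum_prob he

/-- A test followed by discarding is an observation-test, so causality identifies its total
probability with that of discarding at once: no signalling from later tests. -/
theorem IsEvent.sum_weight {X : Type*} [Fintype X] {A B : C} {r : 𝟙_ C ⟶ A} (hr : T.IsEvent r)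
    {t : X → (A ⟶ B)} (ht : T.IsTestUpTo t) : ∑ x, T.weight (r ≫ t x) = T.weight r := by
  simpa [weight] using hr.sum_prob (ht.comp_deterministic (isDeterministic_discard B))

theorem IsEvent.weight_deterministic {A B : C} {r : 𝟙_ C ⟶ A} (hr : T.IsEvent r) {e : A ⟶ B}
    (he : T.IsDeterministic e) : T.weight (r ≫ e) = T.weight r := by
  simpa using hr.sum_weight he

theorem IsEvent.weight_eq_prob {r : 𝟙_ C ⟶ 𝟙_ C} (hr : T.IsEvent r) :
    T.weight r = T.prob r := by
  simpa using (hr.prob_deterministic (isDeterministic_id _)).symm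

theorem weight_id_unit : T.weight (𝟙 (𝟙_ C)) = 1 := by
  rw [(isDeterministic_id _).isEvent.weight_eq_prob]
  simpa using (T.prob_test _ (T.isTest_id (𝟙_ C))).2

/-- Discarding both blocks separately is a deterministic effect on the joint wires, so it may
replace the chosen one; the result is a product of two scalars. -/
theorem IsEvent.weight_applyFront {E : Type w} {sys : E → C} {L L' : List E}
    {r : 𝟙_ C ⟶ composite sys L} {s : 𝟙_ C ⟶ composite sys L'} (hr : T.IsEvent r)
    (hs : T.IsEvent s) :
    T.weight (r ≫ _root_.applyFront (A := []) s L) = T.weight r * T.weight s := by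
  have hd : T.IsDeterministic ((compositeAppend sys L L').hom ≫
      (T.discard _ ⊗ₘ T.discard _) ≫ (λ_ (𝟙_ C)).hom) :=
    (isDeterministic_compositeAppend_hom L L').comp
      (((isDeterministic_discard _).tensor (isDeterministic_discard _)).comp
        (T.isTest_leftUnitor_hom _).isTestUpTo)
  rw [← (hr.comp (hs.applyFront (A := []) L)).prob_deterministic hd, weight, weight,
    ← (hr.comp (isDeterministic_discard _).isEvent).prob_comp
      (hs.comp (isDeterministic_discard _).isEvent)]
  congr 1
  rw [← prepare_whiskerRight_discard]
  simp only [_root_.applyFront, Category.assoc, Iso.inv_hom_id_assoc]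
  rfl

end CausalOPT

/-! ### Wires at a node, and extremal nodes. -/

namespace GDAG

variable {V : Type w} (G : GDAG V)

theorem not_edge_self (v : V) : ¬ G.edge v v := fun h => G.acyclic v (.single h)

variable [Finite V]

theorem mem_inWires {v : V} {e : G.UEdge} : e ∈ G.inWires v ↔ e.1.2 = v := by
  simp [inWires]

theorem mem_outWires {v : V} {e : G.UEdge} : e ∈ G.outWires v ↔ e.1.1 = v := by
  simp [outWires]

theorem nodup_inWires (v : V) : (G.inWires v).Nodup := Finset.nodup_toList _

theorem nodup_outWires (v : V) : (G.outWires v).Nodup := Finset.nodup_toList _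

theorem exists_minimal {S : Set V} (hS : S.Nonempty) : ∃ v ∈ S, ∀ a ∈ S, ¬ G.edge a v := by
  have : Std.Irrefl (Relation.TransGen G.edge) := ⟨G.acyclic⟩
  obtain ⟨v, hv, h⟩ :=
    (Finite.wellFounded_of_trans_of_irrefl (Relation.TransGen G.edge)).has_min S hS
  exact ⟨v, hv, fun a ha hav => h a ha (.single hav)⟩

theorem exists_maximal {S : Set V} (hS : S.Nonempty) : ∃ v ∈ S, ∀ a ∈ S, ¬ G.edge v a := by
  have : Std.Irrefl (fun a b => Relation.TransGen G.edge b a) := ⟨G.acyclic⟩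
  have : IsTrans V (fun a b => Relation.TransGen G.edge b a) := ⟨fun _ _ _ h h' => h'.trans h⟩
  obtain ⟨v, hv, h⟩ :=
    (Finite.wellFounded_of_trans_of_irrefl (fun a b => Relation.TransGen G.edge b a)).has_min S hS
  exact ⟨v, hv, fun a ha hav => h a ha (.single hav)⟩

end GDAG

/-! ### Reordering and splitting circuits. -/

namespace CircuitModel

variable {C : Type (u + 1)} [LargeCategory C] [MonoidalCategory C] [SymmetricCategory C]
  {T : CausalOPT C} {V : Type w} [Fintype V] {G : GDAG V} {Ω : G.observed → Type}
  [∀ i, Finite (Ω i)] (M : CircuitModel T G Ω)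

theorem isTestUpTo_event (x : ∀ i, Ω i) (v : V) :
    T.IsTestUpTo (M.test v fun j => x j.1) :=
  have : Finite (G.Outcome Ω v) := inferInstance
  (M.isTest v _).isTestUpTo

variable [DecidableEq V]

/-- Circuits of the events of some of the nodes. Unlike for `Partial`, observed parents of a node
need not be part of the circuit. -/
inductive Subcircuit : Finset V → ∀ L : List G.UEdge,
    ((∀ i, Ω i) → (𝟙_ C ⟶ composite M.sys L)) → Prop
  | empty : Subcircuit ∅ [] (fun _ => 𝟙 _)
  | rewire {S : Finset V} {L L' : List G.UEdge} {f : (∀ i, Ω i) → (𝟙_ C ⟶ composite M.sys L)}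
      {σ : composite M.sys L ⟶ composite M.sys L'} :
      Subcircuit S L f → Rewiring M.sys L L' σ → Subcircuit S L' (fun x => f x ≫ σ)
  | node {S : Finset V} (v : V) {R : List G.UEdge}
      {f : (∀ i, Ω i) → (𝟙_ C ⟶ composite M.sys (G.inWires v ++ R))} :
      v ∉ S → Subcircuit S (G.inWires v ++ R) f →
      Subcircuit (insert v S) (G.outWires v ++ R) (fun x => f x ≫ applyFront (M.event x v) R)

variable {M} {S : Finset V} {L : List G.UEdge} {f : (∀ i, Ω i) → (𝟙_ C ⟶ composite M.sys L)}

theorem Partial.subcircuit (h : M.Partial S L f) : M.Subcircuit S L f := by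
  induction h with
  | empty => exact .empty
  | rewire _ hσ ih => exact ih.rewire hσ
  | node v hv _ _ ih => exact ih.node v hv

namespace Subcircuit

/-- A node consumes exactly its incoming wires, which were open, and opens its outgoing ones. So the
open wires are the unobserved edges leaving `S`, each once; the absence of duplicates is what
`Rewiring.unique` needs. -/
theorem openWires_spec (h : M.Subcircuit S L f) :
    (∀ e : G.UEdge, e.1.2 ∈ S → e.1.1 ∈ S) ∧ L.Nodup ∧
      ∀ e : G.UEdge, e ∈ L ↔ e.1.1 ∈ S ∧ e.1.2 ∉ S := by
  induction h with
  | empty => simp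
  | rewire _ hσ ih =>
    obtain ⟨h1, h2, h3⟩ := ih
    exact ⟨h1, hσ.perm.nodup_iff.1 h2, fun e => hσ.perm.mem_iff.symm.trans (h3 e)⟩
  | @node S v R f hv _ ih =>
    obtain ⟨h1, h2, h3⟩ := ih
    have hd := List.nodup_append'.1 h2
    have hR : ∀ e ∈ R, e.1.1 ∈ S ∧ e.1.2 ∉ S ∧ e.1.2 ≠ v := fun e he =>
      have := (h3 e).1 (List.mem_append_right _ he)
      ⟨this.1, this.2, fun h => hd.2.2 (G.mem_inWires.2 h) he⟩
    refine ⟨fun e he => ?_, ?_, fun e => ?_⟩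
    · rcases Finset.mem_insert.1 he with he | he
      · exact Finset.mem_insert_of_mem ((h3 e).1 (List.mem_append_left _ (G.mem_inWires.2 he))).1
      · exact Finset.mem_insert_of_mem (h1 e he)
    · refine List.nodup_append'.2 ⟨G.nodup_outWires v, hd.2.1, fun e he he' => hv ?_⟩
      exact G.mem_outWires.1 he ▸ (hR e he').1
    · rw [List.mem_append, G.mem_outWires, Finset.mem_insert, Finset.mem_insert, not_or]
      constructor
      · rintro (he | he)
        · refine ⟨.inl he, fun h => G.not_edge_self v ?_, fun h => hv (he ▸ h1 e h)⟩
          have := e.2.1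
          rwa [he, h] at this
        · exact ⟨.inr (hR e he).1, (hR e he).2.2, (hR e he).2.1⟩
      · rintro ⟨he | he, hne, hnm⟩
        · exact .inl he
        · have := (h3 e).2 ⟨he, hnm⟩
          rw [List.mem_append, G.mem_inWires] at this
          exact .inr (this.resolve_left hne)

theorem nodup (h : M.Subcircuit S L f) : L.Nodup := h.openWires_spec.2.1

theorem mem_iff (h : M.Subcircuit S L f) {e : G.UEdge} : e ∈ L ↔ e.1.1 ∈ S ∧ e.1.2 ∉ S :=
  h.openWires_spec.2.2 e

theorem isEvent (h : M.Subcircuit S L f) (x : ∀ i, Ω i) : T.IsEvent (f x) := by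
  induction h with
  | empty => exact (CausalOPT.isDeterministic_id _).isEvent
  | rewire _ hσ ih => exact ih.comp hσ.isDeterministic.isEvent
  | @node S v R f hv _ ih =>
    exact ih.comp (((M.isTestUpTo_event x v).applyFront R).isEvent fun h => x ⟨v, h⟩)

/-- A circuit depends only on the variables at its nodes and at their parents. -/
theorem congr (h : M.Subcircuit S L f) {x x' : ∀ i, Ω i}
    (hx : ∀ i : G.observed, ((i : V) ∈ S ∨ ∃ v ∈ S, G.edge i v) → x i = x' i) : f x = f x' := by
  induction h with
  | empty => rfl
  | rewire _ hσ ih => simp only [ih hx]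
  | @node S v R f hv _ ih =>
    have he : M.event x v = M.event x' v := by
      unfold event
      congr 1
      · funext j
        exact hx _ (.inr ⟨v, Finset.mem_insert_self _ _, j.2⟩)
      · funext hv
        exact hx _ (.inl (Finset.mem_insert_self _ _))
    simp only [he, ih fun i hi => hx i (hi.imp Finset.mem_insert_of_mem
      fun ⟨v, hv, h⟩ => ⟨v, Finset.mem_insert_of_mem hv, h⟩)]

/-- A node none of whose unobserved edges ends in the circuit can be applied last. -/
theorem exists_last (h : M.Subcircuit S L f) {v : V} (hv : v ∈ S)
    (hmax : ∀ e : G.UEdge, e.1.1 = v → e.1.2 ∉ S) :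
    ∃ R g σ, M.Subcircuit (S.erase v) (G.inWires v ++ R) g ∧
      Rewiring M.sys (G.outWires v ++ R) L σ ∧
      ∀ x, f x = g x ≫ applyFront (M.event x v) R ≫ σ := by
  induction h with
  | empty => simp at hv
  | rewire _ hσ ih =>
    obtain ⟨R, g, τ, h1, h2, h3⟩ := ih hv hmax
    exact ⟨R, g, _, h1, h2.trans hσ, fun x => by simp [h3]⟩
  | @node S w R f hw hS ih =>
    by_cases hvw : v = w
    · subst hvw
      exact ⟨R, f, _, by rwa [Finset.erase_insert hw], .refl _, fun x => by simp⟩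
    replace hv := (Finset.mem_insert.1 hv).resolve_left hvw
    -- Here `w` was applied after `v`. No wire of `v` ends at `w`, so all outputs of `v` bypass `w`,
    -- and the two events can be interchanged.
    obtain ⟨R₁, g, σ, h1, h2, h3⟩ :=
      ih hv fun e he h => hmax e he (Finset.mem_insert_of_mem h)
    obtain ⟨R₂, hR₂⟩ := (G.nodup_outWires v).exists_perm_append (R := R) fun e he => by
      rw [G.mem_outWires] at he
      have he' := hmax e he
      rw [Finset.mem_insert, not_or] at he'
      have := hS.mem_iff.2 ⟨he ▸ hv, he'.2⟩
      rw [List.mem_append, G.mem_inWires] at this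
      exact this.resolve_left he'.1
    have hR₁ : R₁.Perm (G.inWires w ++ R₂) := by
      refine (List.perm_append_left_iff (G.outWires v)).1 (h2.perm.trans ?_)
      refine (hR₂.append_left _).trans ?_
      rw [← List.append_assoc, ← List.append_assoc]
      exact List.perm_append_comm.append_right _
    obtain ⟨ρ, hρ⟩ := Rewiring.exists_of_perm (sys := M.sys) hR₁
    obtain ⟨ρ₂, hρ₂⟩ := Rewiring.exists_of_perm (sys := M.sys) hR₂.symm
    -- By coherence the unknown rewiring between the two events may be replaced by one that just
    -- exchanges blocks.
    have hσ : σ = applyBehind _ ρ ≫ moveBlock (G.outWires v) (G.inWires w) R₂ ≫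
        applyBehind _ ρ₂ :=
      h2.unique ((hρ.applyBehind _).trans ((Rewiring.moveBlock _ _ _).trans (hρ₂.applyBehind _)))
        (h2.perm.nodup_iff.2 hS.nodup)
    have hg := ((h1.rewire (hρ.applyBehind _)).rewire
      (.moveBlock (G.inWires v) (G.inWires w) R₂)).node w (fun h => hw (Finset.mem_of_mem_erase h))
    -- In the new order `w` acts first, after which `τ` brings the inputs of `v` back to the front.
    obtain ⟨τ, hτ, hτ'⟩ := (Rewiring.moveBlock (sys := M.sys) (G.inWires v) (G.outWires w)
      R₂).exists_inverse
    refine ⟨G.outWires w ++ R₂, fun x => g x ≫ applyBehind _ ρ ≫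
      applyBehind _ (applyFront (M.event x w) R₂),
      moveBlock (G.outWires v) (G.outWires w) R₂ ≫ applyBehind _ ρ₂,
      ?_, (Rewiring.moveBlock _ _ _).trans (hρ₂.applyBehind _), fun x => ?_⟩
    · rw [Finset.erase_insert_of_ne (Ne.symm hvw)]
      convert hg.rewire hτ using 2 with x
      simp only [Category.assoc]
      rw [← Category.assoc (moveBlock _ _ _), moveBlock_applyFront, Category.assoc, hτ',
        Category.comp_id]
    · simp only [h3, hσ]
      simp only [Category.assoc]
      rw [← applyFront_applyBehind (M.event x w) ρ₂]
      rw [← Category.assoc (moveBlock _ _ _), moveBlock_applyFront]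
      rw [← Category.assoc (applyFront (M.event x v) R₁), applyFront_applyBehind]
      simp only [Category.assoc]
      rw [← Category.assoc (applyFront (M.event x v) _), applyFront_applyBehind]
      simp only [Category.assoc]

/-- A circuit splits along a partition of its nodes that no unobserved edge crosses. -/
theorem exists_split (h : M.Subcircuit S L f) {S₁ : Finset V} (hS₁ : S₁ ⊆ S)
    (hc : ∀ e : G.UEdge, e.1.1 ∈ S → e.1.2 ∈ S → (e.1.1 ∈ S₁ ↔ e.1.2 ∈ S₁)) :
    ∃ L₁ f₁ L₂ f₂ σ, M.Subcircuit S₁ L₁ f₁ ∧ M.Subcircuit (S \ S₁) L₂ f₂ ∧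
      Rewiring M.sys (L₂ ++ L₁) L σ ∧
      ∀ x, f x = f₁ x ≫ applyFront (A := []) (f₂ x) L₁ ≫ σ := by
  induction hn : S₁.card generalizing S₁ S L with
  | zero =>
    obtain rfl := Finset.card_eq_zero.1 hn
    refine ⟨[], _, L, f, _, .empty, by rwa [Finset.sdiff_empty], .appendNil L, fun x => ?_⟩
    exact (prepare_applyFront_nil (f x)).symm
  | succ n ih =>
    -- A maximal node of `S₁` has no unobserved edge into `S` at all, since by `hc` such an edge
    -- would end in `S₁`. It can be applied last, and after splitting the rest it rejoins the first
    -- factor.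
    obtain ⟨v, hv, hmax⟩ := G.exists_maximal (S := (S₁ : Set V))
      (Finset.coe_nonempty.2 (Finset.card_pos.1 (by omega)))
    rw [Finset.mem_coe] at hv
    have hmax' : ∀ e : G.UEdge, e.1.1 = v → e.1.2 ∉ S := fun e he he' =>
      hmax e.1.2 ((hc e (he ▸ hS₁ hv) he').1 (he ▸ hv)) (he ▸ e.2.1)
    obtain ⟨R, g, σ, h1, h2, h3⟩ := h.exists_last (hS₁ hv) hmax'
    obtain ⟨L₁, f₁, L₂, f₂, τ, hf₁, hf₂, hτ, hg⟩ := ih h1 (S₁ := S₁.erase v)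
      (Finset.erase_subset_erase v hS₁) (fun e he he' => by
        rw [Finset.mem_erase] at he he'
        simp only [Finset.mem_erase, he.1, he'.1, ne_eq, not_false_eq_true, true_and]
        exact hc e he.2 he'.2) (by rw [Finset.card_erase_of_mem hv]; omega)
    -- All inputs of `v` come from `S₁`, so they are open wires of the first factor.
    obtain ⟨L₁', hL₁'⟩ := (G.nodup_inWires v).exists_perm_append (R := L₁) fun e he => by
      have he' := (h1.mem_iff.1 (List.mem_append_left R he)).1
      rw [G.mem_inWires] at he
      rw [Finset.mem_erase] at he'
      exact hf₁.mem_iff.2 ⟨Finset.mem_erase.2 ⟨he'.1, (hc e he'.2 (he ▸ hS₁ hv)).2 (he ▸ hv)⟩,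
        by simp [he]⟩
    have hR : (L₂ ++ L₁').Perm R := by
      refine (List.perm_append_left_iff (G.inWires v)).1 (List.Perm.trans ?_ hτ.perm)
      refine List.Perm.trans ?_ (hL₁'.symm.append_left _)
      rw [← List.append_assoc, ← List.append_assoc]
      exact List.perm_append_comm.append_right _
    obtain ⟨ρ, hρ⟩ := Rewiring.exists_of_perm (sys := M.sys) hL₁'
    obtain ⟨ρ₂, hρ₂⟩ := Rewiring.exists_of_perm (sys := M.sys) hR
    have hτ' : τ = applyBehind _ ρ ≫ moveBlock L₂ (G.inWires v) L₁' ≫ applyBehind _ ρ₂ :=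
      hτ.unique ((hρ.applyBehind _).trans ((Rewiring.moveBlock _ _ _).trans (hρ₂.applyBehind _)))
        (hτ.perm.nodup_iff.2 h1.nodup)
    refine ⟨_, fun x => (f₁ x ≫ ρ) ≫ applyFront (M.event x v) L₁', L₂, f₂,
      moveBlock L₂ (G.outWires v) L₁' ≫ applyBehind _ ρ₂ ≫ σ, ?_, ?_,
      (Rewiring.moveBlock _ _ _).trans ((hρ₂.applyBehind _).trans h2), fun x => ?_⟩
    · have := (hf₁.rewire hρ).node v (Finset.notMem_erase v S₁)
      rwa [Finset.insert_erase hv] at this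
    · convert hf₂ using 1
      ext w
      simp only [Finset.mem_sdiff, Finset.mem_erase]
      grind
    · rw [h3, hg, hτ']
      have e1 := applyFront_applyBehind (A := []) (f₂ x) ρ
      have e2 := applyFront_applyBehind (A := []) (f₂ x) (applyFront (M.event x v) L₁')
      simp only [applyBehind] at e1 e2
      replace e1 := reassoc_of% e1
      replace e2 := reassoc_of% e2
      simp only [Category.assoc]
      rw [← Category.assoc (applyBehind _ ρ₂), ← applyFront_applyBehind (M.event x v) ρ₂]
      simp only [Category.assoc]
      rw [← Category.assoc (moveBlock _ _ _), moveBlock_applyFront]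
      simp only [Category.assoc]
      rw [e1, e2]

end Subcircuit
end CircuitModel

/-! ### Marginals and factorisation. -/

section Marginal

variable {V : Type w} [DecidableEq V] {O : Finset V} {Ω : O → Type} [∀ i, Fintype (Ω i)]

theorem marginal_univ (P : (∀ i, Ω i) → ℝ) (a : ∀ i, Ω i) : marginal P Set.univ a = P a := by
  classical
  rw [marginal, Finset.sum_eq_single a]
  · intro x hx hne
    simp only [Finset.mem_filter, Finset.mem_univ, true_and] at hx
    exact absurd (funext fun i => hx i trivial) hne
  · simp

theorem marginal_empty (P : (∀ i, Ω i) → ℝ) (a : ∀ i, Ω i) : marginal P ∅ a = ∑ x, P x := by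
  simp [marginal]

theorem sum_marginal_insert (P : (∀ i, Ω i) → ℝ) {S : Set V} {i : O} (hi : (i : V) ∉ S)
    (a : ∀ i, Ω i) :
    ∑ ω, marginal P (insert (i : V) S) (Function.update a i ω) = marginal P S a := by
  classical
  unfold marginal
  rw [← Finset.sum_fiberwise _ (fun x : ∀ i, Ω i => x i)]
  refine Finset.sum_congr rfl fun ω _ => Finset.sum_congr ?_ fun _ _ => rfl
  ext x
  simp only [Finset.mem_filter, Finset.mem_univ, true_and, Set.mem_insert_iff]
  constructor
  · intro h
    refine ⟨fun j hj => ?_, by simpa using h i (.inl rfl)⟩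
    have hne : j ≠ i := by
      rintro rfl
      exact hi hj
    simpa [hne] using h j (.inr hj)
  · rintro ⟨h, rfl⟩ j hj
    by_cases hji : j = i
    · subst hji
      simp
    · rw [Function.update_of_ne hji]
      exact h j (hj.resolve_left fun h => hji (Subtype.ext h))

theorem marginal_congr (P : (∀ i, Ω i) → ℝ) {S S' : Set V}
    (h : ∀ i : O, (i : V) ∈ S ↔ (i : V) ∈ S') : marginal P S = marginal P S' := by
  classical
  funext a
  unfold marginal
  congr 1
  ext x
  simp only [Finset.mem_filter, h]

theorem marginal_marginal (P : (∀ i, Ω i) → ℝ) {U U' : Set V} (hU : U ⊆ U')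
    (a : ∀ i, Ω i) : marginal (marginal P U') (U' \ U)ᶜ a = marginal P U a := by
  classical
  -- The points that agree with `a` on `U` are fibred over their values on `U' \ U`; `g` keeps these
  -- values and resets all others to those of `a`.
  let g : (∀ i, Ω i) → (∀ i, Ω i) := fun y i => if (i : V) ∈ U' \ U then y i else a i
  have hg : ∀ y, ∀ i : O, (i : V) ∈ (U' \ U)ᶜ → g y i = a i := fun y i hi => if_neg hi
  have hg' : ∀ y, ∀ i : O, (i : V) ∈ U' \ U → g y i = y i := fun y i hi => if_pos hi
  unfold marginal
  refine Eq.trans (Finset.sum_congr rfl fun x hx => Finset.sum_congr ?_ fun _ _ => rfl)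
    (Finset.sum_fiberwise_of_maps_to (g := g)
      (fun y _ => by
        simp only [Finset.mem_filter, Finset.mem_univ, true_and]
        exact hg y) _)
  simp only [Finset.mem_filter, Finset.mem_univ, true_and] at hx
  ext y
  simp only [Finset.mem_filter, Finset.mem_univ, true_and]
  symm
  constructor
  · rintro ⟨h, rfl⟩ i hi
    by_cases hi' : (i : V) ∈ U' \ U
    · exact (hg' y i hi').symm
    · rw [hg y i hi']
      exact h i (by_contra fun h => hi' ⟨hi, h⟩)
  · intro h
    refine ⟨fun i hi => (h i (hU hi)).trans (hx i fun h => h.2 hi), ?_⟩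
    funext i
    by_cases hi' : (i : V) ∈ U' \ U
    · rw [hg' y i hi', h i hi'.1]
    · rw [hg y i hi', hx i hi']

/-- Fubini for finite sums: the `A`-coordinates and the `B`-coordinates are summed independently,
each affecting only one factor. -/
theorem marginal_mul_of_disjoint {A B : Set V} (hAB : Disjoint A B)
    {q₁ q₂ : (∀ i, Ω i) → ℝ}
    (h₁ : ∀ x x' : ∀ i, Ω i, (∀ i : O, (i : V) ∉ B → x i = x' i) → q₁ x = q₁ x')
    (h₂ : ∀ x x' : ∀ i, Ω i, (∀ i : O, (i : V) ∉ A → x i = x' i) → q₂ x = q₂ x')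
    (a : ∀ i, Ω i) :
    marginal (fun x => q₁ x * q₂ x) (A ∪ B)ᶜ a = marginal q₁ Aᶜ a * marginal q₂ Bᶜ a := by
  classical
  unfold marginal
  rw [Finset.sum_mul_sum, ← Finset.sum_product']
  have hd : ∀ {v : V}, v ∈ B → v ∉ A := fun h h' => Set.disjoint_left.1 hAB h' h
  simp only [Set.mem_compl_iff, Set.mem_union, not_or]
  refine Finset.sum_nbij'
    (fun x => (fun i => if (i : V) ∈ A then x i else a i,
      fun i => if (i : V) ∈ B then x i else a i))
    (fun p i => if (i : V) ∈ A then p.1 i else p.2 i) ?_ ?_ ?_ ?_ ?_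
  · intro x _
    simp +contextual
  · intro p hp
    simp only [Finset.mem_product, Finset.mem_filter, Finset.mem_univ, true_and] at hp ⊢
    intro i hi
    rw [if_neg hi.1, hp.2 i hi.2]
  · intro x hx
    replace hx := (Finset.mem_filter.1 hx).2
    funext i
    by_cases hA : (i : V) ∈ A
    · simp [hA]
    · by_cases hB : (i : V) ∈ B
      · simp [hA, hB]
      · simp [hA, hB, hx i ⟨hA, hB⟩]
  · intro p hp
    simp only [Finset.mem_product, Finset.mem_filter, Finset.mem_univ, true_and] at hp
    refine Prod.ext ?_ ?_ <;> funext i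
    · by_cases hA : (i : V) ∈ A
      · simp [hA]
      · simp [hA, hp.1 i hA]
    · by_cases hB : (i : V) ∈ B
      · simp [hB, hd hB]
      · simp [hB, hp.2 i hB]
  · intro x hx
    replace hx := (Finset.mem_filter.1 hx).2
    congr 1
    · refine h₁ _ _ fun i hi => ?_
      by_cases hA : (i : V) ∈ A
      · simp [hA]
      · simp [hA, hx i ⟨hA, hi⟩]
    · refine h₂ _ _ fun i hi => ?_
      by_cases hB : (i : V) ∈ B
      · simp [hB]
      · simp [hB, hx i ⟨hi, hB⟩]

/-- If the joint distribution of `D`, `R` and `Z` is a product of a function of `D` and `Z` and a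
function of `R` and `Z`, then any parts of `D` and of `R` are independent given `Z`. -/
theorem condIndepSets_of_factor {P : (∀ i, Ω i) → ℝ} {D R Z X Y : Set V} (hDR : Disjoint D R)
    (hDZ : Disjoint D Z) (hRZ : Disjoint R Z) {q₁ q₂ : (∀ i, Ω i) → ℝ}
    (hq : ∀ a, marginal P (D ∪ R ∪ Z) a = q₁ a * q₂ a)
    (h₁ : ∀ x x' : ∀ i, Ω i, (∀ i : O, (i : V) ∉ R → x i = x' i) → q₁ x = q₁ x')
    (h₂ : ∀ x x' : ∀ i, Ω i, (∀ i : O, (i : V) ∉ D → x i = x' i) → q₂ x = q₂ x')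
    (hX : X ⊆ D) (hY : Y ⊆ R) : CondIndepSets P X Y Z := by
  intro a ha
  -- All four marginals in the independence statement have this form, with `X'` either empty or `X`
  -- and `Y'` either empty or `Y`.
  have key : ∀ X' Y' : Set V, X' ⊆ D → Y' ⊆ R → marginal P (X' ∪ Y' ∪ Z) a =
      marginal q₁ (D \ X')ᶜ a * marginal q₂ (R \ Y')ᶜ a := by
    intro X' Y' hX' hY'
    have hs : (D ∪ R ∪ Z) \ (X' ∪ Y' ∪ Z) = D \ X' ∪ R \ Y' := by
      ext v
      have h1 : v ∈ X' → v ∈ D := @hX' v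
      have h2 : v ∈ Y' → v ∈ R := @hY' v
      have h3 : v ∈ D → v ∉ R := fun h => Set.disjoint_left.1 hDR h
      have h4 : v ∈ D → v ∉ Z := fun h => Set.disjoint_left.1 hDZ h
      have h5 : v ∈ R → v ∉ Z := fun h => Set.disjoint_left.1 hRZ h
      simp only [Set.mem_sdiff, Set.mem_union]
      tauto
    rw [← marginal_marginal P (U' := D ∪ R ∪ Z)
      (Set.union_subset_union_left _ (Set.union_subset_union hX' hY')), hs, funext hq]
    exact marginal_mul_of_disjoint
      (hDR.mono Set.sdiff_subset Set.sdiff_subset)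
      (fun x x' h => h₁ x x' fun i hi => h i fun h => hi h.1)
      (fun x x' h => h₂ x x' fun i hi => h i fun h => hi h.1) a
  have k0 := key ∅ ∅ (Set.empty_subset _) (Set.empty_subset _)
  have k1 := key X ∅ hX (Set.empty_subset _)
  have k2 := key ∅ Y (Set.empty_subset _) hY
  have k3 := key X Y hX hY
  simp only [Set.union_empty, Set.empty_union] at k0 k1 k2
  rw [k0] at ha
  rw [k0, k1, k2, k3]
  have h1 := left_ne_zero_of_mul ha
  have h2 := right_ne_zero_of_mul ha
  field_simp

end Marginal

/-! ### Marginals of ancestral sets as weights of circuits. -/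

namespace CircuitModel

variable {C : Type (u + 1)} [LargeCategory C] [MonoidalCategory C] [SymmetricCategory C]
  {T : CausalOPT C} {V : Type w} [Fintype V] [DecidableEq V] {G : GDAG V} {Ω : G.observed → Type}
  [∀ i, Fintype (Ω i)] {M : CircuitModel T G Ω} {P : (∀ i, Ω i) → ℝ}

/-- The marginal of a set of nodes that contains all ancestors of its nodes is obtained from the
circuit of these nodes, by discarding its open wires. -/
theorem Realises.exists_subcircuit (h : M.Realises P) {S : Finset V}
    (hS : ∀ a b, G.edge a b → b ∈ S → a ∈ S) :
    ∃ L f, M.Subcircuit S L f ∧ ∀ a, marginal P S a = T.weight (f a) := by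
  induction hn : Sᶜ.card generalizing S with
  | zero =>
    rw [Finset.card_eq_zero, Finset.compl_eq_empty_iff] at hn
    subst hn
    obtain ⟨f, hf, hP⟩ := h
    refine ⟨[], f, hf.subcircuit, fun a => ?_⟩
    rw [Finset.coe_univ, marginal_univ, hP]
    exact (CausalOPT.IsEvent.weight_eq_prob (hf.subcircuit.isEvent a)).symm
  | succ n ih =>
    -- Adding a minimal missing node keeps the set ancestral, and this node has no child in it, so
    -- it can be applied last and removed by causality.
    obtain ⟨v, hv, hmin⟩ := G.exists_minimal (S := (Sᶜ : Finset V))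
      (Finset.coe_nonempty.2 (Finset.card_pos.1 (by omega)))
    simp only [Finset.coe_compl, Set.mem_compl_iff, Finset.mem_coe] at hv hmin
    have hpar : ∀ a, G.edge a v → a ∈ S := fun a ha => by_contra fun h => hmin a h ha
    have hS' : ∀ a b, G.edge a b → b ∈ insert v S → a ∈ insert v S := fun a b hab hb => by
      rcases Finset.mem_insert.1 hb with rfl | hb
      · exact Finset.mem_insert_of_mem (hpar a hab)
      · exact Finset.mem_insert_of_mem (hS a b hab hb)
    have hchild : ∀ b, G.edge v b → b ∉ insert v S := fun b hb h => by
      rcases Finset.mem_insert.1 h with rfl | h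
      · exact G.not_edge_self _ hb
      · exact hv (hS _ _ hb h)
    obtain ⟨L, f, hf, hm⟩ := ih hS' (by
      rw [Finset.compl_insert, Finset.card_erase_of_mem (by simpa using hv)]
      omega)
    obtain ⟨R, g, σ, hg, hσ, hfg⟩ := hf.exists_last (Finset.mem_insert_self v S)
      fun e he => hchild _ (he ▸ e.2.1)
    rw [Finset.erase_insert hv] at hg
    have ht : ∀ a : ∀ i, Ω i, T.IsTestUpTo fun o =>
        applyFront (M.test v (fun j => a j.1) o) R ≫ σ :=
      fun a => ((M.isTestUpTo_event a v).applyFront R).comp_deterministic hσ.isDeterministic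
    refine ⟨_, g, hg, fun a => ?_⟩
    by_cases ho : v ∈ G.observed
    · let φ : Ω ⟨v, ho⟩ ≃ G.Outcome Ω v :=
        ⟨fun ω _ => ω, fun o => o ho, fun _ => rfl, fun _ => rfl⟩
      rw [← (hg.isEvent a).sum_weight ((ht a).relabel φ), ← sum_marginal_insert P (i := ⟨v, ho⟩) hv]
      refine Finset.sum_congr rfl fun ω _ => ?_
      have hm' := hm (Function.update a ⟨v, ho⟩ ω)
      rw [Finset.coe_insert] at hm'
      rw [hm', hfg]
      have hne : ∀ i : G.observed, (i : V) ≠ v → Function.update a ⟨v, ho⟩ ω i = a i :=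
        fun i hi => Function.update_of_ne (fun h => hi (congrArg Subtype.val h)) _ _
      -- The circuit before `v` contains neither `v` nor a child of `v`, so it ignores the value
      -- that is summed over.
      have hgx : g (Function.update a ⟨v, ho⟩ ω) = g a := hg.congr fun i hi => hne i (by
        rintro rfl
        rcases hi with hi | ⟨w, hw, hi⟩
        · exact hv hi
        · exact hv (hS _ _ hi hw))
      have hev : M.event (Function.update a ⟨v, ho⟩ ω) v = M.test v (fun j => a j.1) (φ ω) := by
        unfold event
        congr 1
        · funext j
          refine hne j.1 fun h => G.not_edge_self v ?_
          have := j.2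
          rwa [h] at this
        · funext h
          exact Function.update_self _ _ _
      rw [hgx, hev]
    -- An unobserved node carries a one-outcome test, so no sum is needed and the marginal does not
    -- notice it.
    · let φ : Unit ≃ G.Outcome Ω v :=
        ⟨fun _ h => absurd h ho, fun _ => (), fun _ => rfl, fun _ => funext fun h => absurd h ho⟩
      rw [← (hg.isEvent a).weight_deterministic
        (e := applyFront (M.test v (fun j => a j.1) (φ ())) R ≫ σ) ((ht a).relabel φ),
        marginal_congr P (S' := ((insert v S : Finset V) : Set V)), hm, hfg]
      · congr 4
        unfold event
        congr 1
        funext h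
        exact absurd h ho
      · intro i
        have : (i : V) ≠ v := by
          rintro rfl
          exact ho i.2
        simp [this]

theorem Subcircuit.weight_eq_one {S : Finset V} {L : List G.UEdge}
    {f : (∀ i, Ω i) → (𝟙_ C ⟶ composite M.sys L)} (h : M.Subcircuit S L f) (hS : S = ∅)
    (x : ∀ i, Ω i) : T.weight (f x) = 1 := by
  induction h with
  | empty => exact CausalOPT.weight_id_unit
  | rewire h hσ ih => rw [(h.isEvent x).weight_deterministic hσ.isDeterministic, ih hS]
  | node v => exact absurd hS (Finset.insert_ne_empty _ _)

theorem Realises.mem_stdSimplex [Nonempty (∀ i, Ω i)] (h : M.Realises P) :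
    P ∈ stdSimplex ℝ (∀ i, Ω i) := by
  constructor
  · obtain ⟨f, hf, hP⟩ := h
    intro x
    rw [hP]
    exact CausalOPT.IsEvent.prob_nonneg (hf.subcircuit.isEvent x)
  · obtain ⟨L, f, hf, hm⟩ := h.exists_subcircuit (S := ∅) (by simp)
    have a := Classical.arbitrary (∀ i, Ω i)
    rw [← marginal_empty P a, ← Finset.coe_empty, hm, hf.weight_eq_one rfl]

end CircuitModel

/-! ### Soundness of d-separation. -/

namespace GDAG

variable {V : Type w} [Fintype V] [DecidableEq V] {G : GDAG V}

/-- Soundness of d-separation. -/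
theorem IsGeneralisedMarkov.condIndepSets {Ω : G.observed → Type} [∀ i, Fintype (Ω i)]
    {P : (∀ i, Ω i) → ℝ} (hP : G.IsGeneralisedMarkov.{u, w} P) {X Y Z : Set V}
    (hZ : Z ⊆ G.observed) (hXZ : Disjoint X Z) (hYZ : Disjoint Y Z) (hsep : G.DSep X Y Z) :
    CondIndepSets P X Y Z := by
  classical
  obtain ⟨C, _, _, _, T, M, hM⟩ := hP
  set An := G.inclusiveAncestors (X ∪ Y ∪ Z) with hAn
  have hsub : X ∪ Y ∪ Z ⊆ An := fun v hv => ⟨v, hv, .refl⟩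
  have hpar : ∀ a b, G.edge a b → b ∈ An → a ∈ An := fun a b hab ⟨c, hc, hbc⟩ =>
    ⟨c, hc, .head hab hbc⟩
  -- A pseudo-path step whose endpoint stays among the relevant ancestors and off `Z`.
  let r : V → V → Prop := fun a b =>
    (b ∈ An ∧ b ∉ Z) ∧ ¬ (G.inclusiveChildren {a} ∩ G.inclusiveChildren {b} ⊆ Anᶜ)
  let D : Set V := {v | ∃ a ∈ X, Relation.ReflTransGen r a v}
  have hXD : X ⊆ D := fun a ha => ⟨a, ha, .refl⟩
  have hDA : D ⊆ An \ Z := by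
    rintro v ⟨a, ha, hav⟩
    rcases hav.cases_tail with rfl | ⟨_, _, h⟩
    · exact ⟨hsub (.inl (.inl ha)), Set.disjoint_left.1 hXZ ha⟩
    · exact h.1
  have hYD : Disjoint Y D := by
    refine Set.disjoint_left.2 fun b hb => ?_
    rintro ⟨a, ha, hab⟩
    obtain ⟨l, hl, hlast⟩ := List.exists_isChain_cons_of_relationReflTransGen hab
    have hlD : ∀ v ∈ a :: l, v ∈ D := hl.induction (· ∈ D) _
      (fun _ _ hr ⟨a, ha, h⟩ => ⟨a, ha, h.tail hr⟩) fun _ => hXD ha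
    obtain ⟨v, hv, hvZ⟩ := hsep a ha b hb (a :: l)
      ⟨fun v hv h => h (hDA (hlD v hv)).1, hl.imp fun _ _ h => h.2⟩ rfl
      (by rw [List.getLast?_eq_some_getLast (List.cons_ne_nil _ _), hlast])
    exact (hDA (hlD v hv)).2 hvZ
  -- The node `v` is itself a common inclusive child of `p` and `p'`, so they are one step apart:
  -- `D` cannot separate a node and its parents except at `Z`.
  have hfam : ∀ v ∈ An, ∀ p p', (p = v ∨ G.edge p v) → (p' = v ∨ G.edge p' v) → p ∈ D →
      p' ∉ Z → p' ∈ D := by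
    rintro v hv p p' hp hp' ⟨a, ha, hap⟩ hZ'
    have hm : ∀ q, (q = v ∨ G.edge q v) → v ∈ G.inclusiveChildren {q} := fun q hq =>
      hq.elim (fun h => .inl h.symm) fun h => .inr ⟨q, rfl, h⟩
    refine ⟨a, ha, hap.tail ⟨⟨?_, hZ'⟩, fun h => h ⟨hm p hp, hm p' hp'⟩ hv⟩⟩
    rcases hp' with rfl | hp'
    · exact hv
    · exact hpar _ _ hp' hv
  let S : Finset V := Finset.univ.filter (· ∈ An)
  let S₁ : Finset V := Finset.univ.filter fun v => v ∈ An ∧ ∃ p ∈ D, p = v ∨ G.edge p v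
  have hS : ∀ {v}, v ∈ S ↔ v ∈ An := by simp [S]
  have hS₁ : ∀ {v}, v ∈ S₁ ↔ v ∈ An ∧ ∃ p ∈ D, p = v ∨ G.edge p v := by simp [S₁]
  obtain ⟨L, f, hf, hm⟩ := hM.exists_subcircuit (S := S)
    fun a b hab hb => hS.2 (hpar a b hab (hS.1 hb))
  -- The source of an unobserved edge is not in `Z` and is itself or a parent for both endpoints. By
  -- `hfam` its membership in `D` decides for both whether they are in `S₁`.
  obtain ⟨L₁, f₁, L₂, f₂, σ, hf₁, hf₂, hσ, hff⟩ := hf.exists_split (S₁ := S₁)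
    (fun v hv => hS.2 (hS₁.1 hv).1) (fun e he he' => by
      rw [hS] at he he'
      have hnZ : e.1.1 ∉ Z := fun h => e.2.2 (hZ h)
      have hD : ∀ {v}, v ∈ An → (e.1.1 = v ∨ G.edge e.1.1 v) →
          ((∃ p ∈ D, p = v ∨ G.edge p v) ↔ e.1.1 ∈ D) := fun {v} hv hev =>
        ⟨fun ⟨p, hp, hpv⟩ => hfam v hv p e.1.1 hpv hev hp hnZ, fun h => ⟨_, h, hev⟩⟩
      rw [hS₁, hS₁, hD he (.inl rfl), hD he' (.inr e.2.1)]
      simp [he, he'])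
  have hU : D ∪ (An \ (D ∪ Z)) ∪ Z = (S : Set V) := by
    ext v
    have h1 := @hDA v
    have h2 := @hsub v
    simp only [Set.mem_union, Set.mem_sdiff, Finset.mem_coe, hS] at h1 h2 ⊢
    tauto
  have hdis : ∀ {A B : Set V}, (∀ v ∈ A, v ∉ B) → Disjoint A B := Set.disjoint_left.2
  refine condIndepSets_of_factor (D := D) (R := An \ (D ∪ Z)) (q₁ := fun a => T.weight (f₁ a))
    (q₂ := fun a => T.weight (f₂ a)) (hdis fun v hv h => h.2 (.inl hv))
    (hdis fun v hv h => (hDA hv).2 h) (hdis fun v hv h => hv.2 (.inr h)) (fun a => ?_)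
    (fun x x' hx => ?_) (fun x x' hx => ?_) hXD
    (fun v hv => ⟨hsub (.inl (.inr hv)), fun h => h.elim (fun h => Set.disjoint_left.1 hYD hv h)
      (fun h => Set.disjoint_left.1 hYZ hv h)⟩)
  · rw [hU, hm, hff, ← Category.assoc]
    rw [(((hf₁.isEvent a).comp ((hf₂.isEvent a).applyFront (A := []) L₁)).weight_deterministic
      hσ.isDeterministic)]
    exact (hf₁.isEvent a).weight_applyFront (hf₂.isEvent a)
  -- Nodes of `S₁` and their parents lie in `D ∪ Z`, so this factor ignores the rest.
  · refine congrArg _ (hf₁.congr fun i hi => hx i fun h => ?_)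
    have : ∃ v ∈ S₁, (i : V) = v ∨ G.edge i v := by
      rcases hi with hi | ⟨v, hv, hi⟩
      exacts [⟨_, hi, .inl rfl⟩, ⟨v, hv, .inr hi⟩]
    obtain ⟨v, hv, hi⟩ := this
    obtain ⟨hv, p, hp, hpv⟩ := hS₁.1 hv
    exact h.2 (.inl (hfam v hv p i hpv hi hp fun h' => h.2 (.inr h')))
  -- A node of `D` that is in, or a parent of a node in, the second piece would put that node into
  -- `S₁`.
  · refine congrArg _ (hf₂.congr fun i hi => hx i fun h => ?_)
    have : ∃ v ∈ S \ S₁, (i : V) = v ∨ G.edge i v := by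
      rcases hi with hi | ⟨v, hv, hi⟩
      exacts [⟨_, hi, .inl rfl⟩, ⟨v, hv, .inr hi⟩]
    obtain ⟨v, hv, hi⟩ := this
    rw [Finset.mem_sdiff, hS, hS₁] at hv
    exact hv.2 ⟨hv.1, i, h, hi⟩

end GDAG

/-! ### Classical probability as a causal theory of matrices. -/

/-- The objects of the category of matrices with entries in `[0, ∞]`. -/
structure WeightMat : Type (u + 1) where
  carrier : Type u

namespace WeightMat

open scoped ENNReal

-- Carriers may be infinite; entries in `[0, ∞]` make every composite defined and every interchange
-- of sums valid without summability conditions.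
open Classical in
noncomputable instance : LargeCategory WeightMat.{u} where
  Hom A B := A.carrier → B.carrier → ℝ≥0∞
  id A := fun a b => if a = b then 1 else 0
  comp f g := fun a c => ∑' b, f a b * g b c
  id_comp f := by
    funext a c
    rw [tsum_eq_single a fun b hb => by simp [hb.symm]]
    simp
  comp_id f := by
    funext a c
    rw [tsum_eq_single c fun b hb => by simp [hb]]
    simp
  assoc f g h := by
    funext a d
    simp only [← ENNReal.tsum_mul_right, ← ENNReal.tsum_mul_left]
    rw [ENNReal.tsum_comm]
    simp only [mul_assoc]

variable {A B D F : WeightMat.{u}}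

theorem comp_apply (f : A ⟶ B) (g : B ⟶ D) (a : A.carrier) (c : D.carrier) :
    (f ≫ g) a c = ∑' b, f a b * g b c := rfl

open Classical in
/-- The matrix of a function. -/
noncomputable def ofFun (φ : A.carrier → B.carrier) : A ⟶ B := fun a b => if φ a = b then 1 else 0

theorem id_eq_ofFun (A : WeightMat.{u}) : 𝟙 A = ofFun id := rfl

theorem ofFun_comp_apply (φ : A.carrier → B.carrier) (g : B ⟶ D) (a : A.carrier) (c : D.carrier) :
    (ofFun φ ≫ g) a c = g (φ a) c := by
  classical
  rw [comp_apply, tsum_eq_single (φ a) fun b hb => by simp [ofFun, hb.symm]]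
  simp [ofFun]

theorem comp_ofFun_apply (f : A ⟶ B) (e : B.carrier ≃ D.carrier) (a : A.carrier)
    (c : D.carrier) : (f ≫ ofFun e) a c = f a (e.symm c) := by
  classical
  rw [comp_apply, tsum_eq_single (e.symm c) fun b hb => ?_]
  · simp [ofFun]
  · rw [ofFun, if_neg fun h => hb (by simp [← h]), mul_zero]

theorem ofFun_comp_ofFun (φ : A.carrier → B.carrier) (ψ : B.carrier → D.carrier) :
    (ofFun φ ≫ ofFun ψ : A ⟶ D) = ofFun (ψ ∘ φ) := by
  funext a c
  rw [ofFun_comp_apply]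
  rfl

/-- The isomorphism given by a permutation matrix. -/
noncomputable def ofEquiv (e : A.carrier ≃ B.carrier) : A ≅ B where
  hom := ofFun e
  inv := ofFun e.symm
  hom_inv_id := by
    rw [ofFun_comp_ofFun, id_eq_ofFun]
    congr 1
    exact e.symm_comp_self
  inv_hom_id := by
    rw [ofFun_comp_ofFun, id_eq_ofFun]
    congr 1
    exact e.self_comp_symm

/-- The Kronecker product of matrices. -/
noncomputable def kronecker (f : A ⟶ B) (g : D ⟶ F) :
    (⟨A.carrier × D.carrier⟩ : WeightMat.{u}) ⟶ ⟨B.carrier × F.carrier⟩ :=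
  fun a b => f a.1 b.1 * g a.2 b.2

theorem kronecker_ofFun (φ : A.carrier → B.carrier) (ψ : D.carrier → F.carrier) :
    kronecker (ofFun φ : A ⟶ B) (ofFun ψ : D ⟶ F) =
      (ofFun (Prod.map φ ψ) :
        (⟨A.carrier × D.carrier⟩ : WeightMat.{u}) ⟶ ⟨B.carrier × F.carrier⟩) := by
  classical
  funext a b
  have h : Prod.map φ ψ a = b ↔ φ a.1 = b.1 ∧ ψ a.2 = b.2 := Prod.ext_iff
  by_cases h₁ : φ a.1 = b.1 <;> by_cases h₂ : ψ a.2 = b.2 <;> simp [kronecker, ofFun, h, h₁, h₂]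

noncomputable instance : MonoidalCategoryStruct WeightMat.{u} where
  tensorObj A B := ⟨A.carrier × B.carrier⟩
  tensorUnit := ⟨PUnit⟩
  tensorHom f g := kronecker f g
  whiskerLeft A _ _ f := kronecker (𝟙 A) f
  whiskerRight f A := kronecker f (𝟙 A)
  associator A B D := ofEquiv (Equiv.prodAssoc A.carrier B.carrier D.carrier)
  leftUnitor A := ofEquiv (Equiv.punitProd A.carrier)
  rightUnitor A := ofEquiv (Equiv.prodPUnit A.carrier)

theorem kronecker_comp {A' B' D' : WeightMat.{u}} (f : A ⟶ B) (g : B ⟶ D) (f' : A' ⟶ B')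
    (g' : B' ⟶ D') :
    kronecker f f' ≫ kronecker g g' = kronecker (f ≫ g) (f' ≫ g') := by
  funext a c
  change ∑' b : B.carrier × B'.carrier, (f a.1 b.1 * f' a.2 b.2) * (g b.1 c.1 * g' b.2 c.2) =
    (∑' b, f a.1 b * g b c.1) * ∑' b, f' a.2 b * g' b c.2
  rw [ENNReal.tsum_prod', ← ENNReal.tsum_mul_right]
  refine tsum_congr fun b => ?_
  rw [← ENNReal.tsum_mul_left]
  exact tsum_congr fun b' => by ring

noncomputable instance : MonoidalCategory WeightMat.{u} := .ofTensorHom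
  (id_tensorHom_id := fun A B => kronecker_ofFun id id)
  (id_tensorHom := fun _ _ _ _ => rfl)
  (tensorHom_id := fun _ _ => rfl)
  (tensorHom_comp_tensorHom := fun f g f' g' => kronecker_comp f f' g g')
  (associator_naturality := fun f g h => by
    funext a b
    refine (comp_ofFun_apply _ (Equiv.prodAssoc _ _ _) a b).trans ?_
    refine Eq.trans ?_ (ofFun_comp_apply (Equiv.prodAssoc _ _ _) _ a b).symm
    exact mul_assoc _ _ _)
  (leftUnitor_naturality := fun f => by
    funext a b
    refine (comp_ofFun_apply _ (Equiv.punitProd _) a b).trans ?_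
    refine Eq.trans ?_ (ofFun_comp_apply (Equiv.punitProd _) _ a b).symm
    exact (congrArg (· * _) (if_pos rfl)).trans (one_mul _))
  (rightUnitor_naturality := fun f => by
    funext a b
    refine (comp_ofFun_apply _ (Equiv.prodPUnit _) a b).trans ?_
    refine Eq.trans ?_ (ofFun_comp_apply (Equiv.prodPUnit _) _ a b).symm
    exact (congrArg (_ * ·) (if_pos rfl)).trans (mul_one _))
  (pentagon := fun A B D F => by
    change kronecker (ofFun (Equiv.prodAssoc _ _ _)) (ofFun id) ≫ ofFun (Equiv.prodAssoc _ _ _) ≫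
      kronecker (ofFun id) (ofFun (Equiv.prodAssoc _ _ _)) =
      ofFun (Equiv.prodAssoc _ _ _) ≫ ofFun (Equiv.prodAssoc _ _ _)
    rw [kronecker_ofFun, kronecker_ofFun, ofFun_comp_ofFun]
    erw [ofFun_comp_ofFun, ofFun_comp_ofFun]
    rfl)
  (triangle := fun A B => by
    change ofFun (Equiv.prodAssoc _ _ _) ≫ kronecker (ofFun id) (ofFun (Equiv.punitProd _)) =
      kronecker (ofFun (Equiv.prodPUnit _)) (ofFun id)
    rw [kronecker_ofFun, kronecker_ofFun]
    erw [ofFun_comp_ofFun]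
    rfl)

noncomputable instance : BraidedCategory WeightMat.{u} where
  braiding A B := ofEquiv (Equiv.prodComm A.carrier B.carrier)
  braiding_naturality_right A _ _ f := by
    funext a b
    refine (comp_ofFun_apply _ (Equiv.prodComm _ _) a b).trans ?_
    refine Eq.trans ?_ (ofFun_comp_apply (Equiv.prodComm _ _) _ a b).symm
    exact mul_comm _ _
  braiding_naturality_left f A := by
    funext a b
    refine (comp_ofFun_apply _ (Equiv.prodComm _ _) a b).trans ?_
    refine Eq.trans ?_ (ofFun_comp_apply (Equiv.prodComm _ _) _ a b).symm
    exact mul_comm _ _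
  hexagon_forward A B D := by
    change ofFun (Equiv.prodAssoc _ _ _) ≫ ofFun (Equiv.prodComm _ _) ≫
        ofFun (Equiv.prodAssoc _ _ _) =
      kronecker (ofFun (Equiv.prodComm _ _)) (ofFun id) ≫ ofFun (Equiv.prodAssoc _ _ _) ≫
        kronecker (ofFun id) (ofFun (Equiv.prodComm _ _))
    rw [kronecker_ofFun, kronecker_ofFun]
    repeat erw [ofFun_comp_ofFun]
    rfl
  hexagon_reverse A B D := by
    change ofFun (Equiv.prodAssoc _ _ _).symm ≫ ofFun (Equiv.prodComm _ _) ≫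
        ofFun (Equiv.prodAssoc _ _ _).symm =
      kronecker (ofFun id) (ofFun (Equiv.prodComm _ _)) ≫ ofFun (Equiv.prodAssoc _ _ _).symm ≫
        kronecker (ofFun (Equiv.prodComm _ _)) (ofFun id)
    rw [kronecker_ofFun, kronecker_ofFun]
    repeat erw [ofFun_comp_ofFun]
    rfl

noncomputable instance : SymmetricCategory WeightMat.{u} where
  symmetry A B := by
    change ofFun (Equiv.prodComm _ _) ≫ ofFun (Equiv.prodComm _ _) = ofFun id
    erw [ofFun_comp_ofFun]
    rfl

theorem tsum_unit (f : (𝟙_ WeightMat.{u}).carrier → ℝ≥0∞) : ∑' b, f b = f PUnit.unit :=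
  tsum_eq_single _ fun b hb => absurd (PUnit.ext b _) hb

/-- The families of matrices whose sum is stochastic. -/
def IsInstrument {X : Type} {A B : WeightMat.{u}} (t : X → (A ⟶ B)) : Prop :=
  ∀ a, ∑' x, ∑' b, t x a b = 1

theorem isInstrument_ofFun (φ : A.carrier → B.carrier) :
    IsInstrument (fun _ : Unit => (ofFun φ : A ⟶ B)) := by
  intro a
  simp [ofFun]

theorem IsInstrument.comp {X Y : Type} {s : X → (A ⟶ B)} {t : Y → (B ⟶ D)} (hs : IsInstrument s)
    (ht : IsInstrument t) : IsInstrument (fun p : X × Y => s p.1 ≫ t p.2) := by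
  intro a
  calc ∑' p : X × Y, ∑' c, ∑' b, s p.1 a b * t p.2 b c
      = ∑' x, ∑' y, ∑' c, ∑' b, s x a b * t y b c := ENNReal.tsum_prod'
    _ = ∑' x, ∑' y, ∑' b, ∑' c, s x a b * t y b c :=
      tsum_congr fun x => tsum_congr fun y => ENNReal.tsum_comm
    _ = ∑' x, ∑' b, ∑' y, ∑' c, s x a b * t y b c := tsum_congr fun x => ENNReal.tsum_comm
    _ = ∑' x, ∑' b, s x a b := by
      simp only [ENNReal.tsum_mul_left, ht _, mul_one]
    _ = 1 := hs a

theorem IsInstrument.tensor {X Y : Type} {s : X → (A ⟶ B)} {t : Y → (D ⟶ F)}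
    (hs : IsInstrument s) (ht : IsInstrument t) :
    IsInstrument (fun p : X × Y => s p.1 ⊗ₘ t p.2) := by
  intro a
  calc ∑' p : X × Y, ∑' c : B.carrier × F.carrier, s p.1 a.1 c.1 * t p.2 a.2 c.2
      = ∑' p : X × Y, (∑' b, s p.1 a.1 b) * ∑' d, t p.2 a.2 d := by
        refine tsum_congr fun p => ?_
        rw [ENNReal.tsum_prod', ← ENNReal.tsum_mul_right]
        exact tsum_congr fun b => by simp only [ENNReal.tsum_mul_left]
    _ = (∑' x, ∑' b, s x a.1 b) * ∑' y, ∑' d, t y a.2 d := by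
        rw [ENNReal.tsum_prod', ← ENNReal.tsum_mul_right]
        exact tsum_congr fun b => by simp only [ENNReal.tsum_mul_left]
    _ = 1 := by rw [hs, ht, mul_one]

theorem IsInstrument.tsum_le_one {X : Type} {t : X → (A ⟶ B)} (ht : IsInstrument t) (x : X)
    (a : A.carrier) : ∑' b, t x a b ≤ 1 :=
  (ENNReal.le_tsum x).trans (ht a).le

theorem IsInstrument.tsum_effect {X : Type} {t : X → (A ⟶ 𝟙_ WeightMat.{u})} (ht : IsInstrument t)
    (a : A.carrier) : ∑' x, t x a PUnit.unit = 1 := by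
  rw [← ht a]
  exact tsum_congr fun x => (tsum_unit _).symm

/-- Classical probability theory. -/
noncomputable def classicalOPT : CausalOPT WeightMat.{u} where
  IsTest t := IsInstrument t
  isTest_id _ := isInstrument_ofFun _
  isTest_associator_hom _ _ _ := isInstrument_ofFun _
  isTest_associator_inv _ _ _ := isInstrument_ofFun _
  isTest_leftUnitor_hom _ := isInstrument_ofFun _
  isTest_leftUnitor_inv _ := isInstrument_ofFun _
  isTest_rightUnitor_hom _ := isInstrument_ofFun _
  isTest_rightUnitor_inv _ := isInstrument_ofFun _
  isTest_braiding _ _ := isInstrument_ofFun _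
  isTest_comp _ _ hs ht := hs.comp ht
  isTest_tensor _ _ hs ht := hs.tensor ht
  prob f := (f PUnit.unit PUnit.unit).toReal
  prob_test t ht := by
    have h := IsInstrument.tsum_effect ht PUnit.unit
    refine ⟨fun x => ENNReal.toReal_nonneg, ?_⟩
    rw [← ENNReal.toReal_sum, ← tsum_fintype (L := .unconditional _), h, ENNReal.toReal_one]
    intro x _
    exact ne_top_of_le_ne_top ENNReal.one_ne_top ((ENNReal.le_tsum x).trans h.le)
  prob_comp s t _ _ x y := by
    rw [← ENNReal.toReal_mul]
    congr 1
    exact tsum_unit _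
  exists_deterministic A := ⟨ofFun fun _ => PUnit.unit, isInstrument_ofFun _⟩
  deterministic_unique a e r ha he hr y := by
    -- Finiteness is needed because `prob` is a `toReal`, which is additive only away from `⊤`.
    have hle : ∀ x, ∑' b, r y PUnit.unit b * a x b PUnit.unit ≤ 1 := fun x => by
      refine le_trans (ENNReal.tsum_le_tsum fun b => ?_) (hr.tsum_le_one y PUnit.unit)
      exact mul_le_of_le_one_right' ((ENNReal.le_tsum x).trans (ha.tsum_effect b).le)
    have he' : ∀ b, e b PUnit.unit = 1 := fun b => by simpa using he.tsum_effect b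
    simp only [comp_apply]
    rw [← ENNReal.toReal_sum fun x _ => ne_top_of_le_ne_top ENNReal.one_ne_top (hle x),
      ← tsum_fintype (L := .unconditional _), ENNReal.tsum_comm]
    simp only [ENNReal.tsum_mul_left, ha.tsum_effect, he']

end WeightMat

/-! ### Existence of the closed circuit. -/

namespace CircuitModel

variable {C : Type (u + 1)} [LargeCategory C] [MonoidalCategory C] [SymmetricCategory C]
  {T : CausalOPT C} {V : Type w} [Fintype V] [DecidableEq V] {G : GDAG V} {Ω : G.observed → Type}
  [∀ i, Finite (Ω i)] (M : CircuitModel T G Ω)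

/-- Removing a maximal node leaves an ancestral set, whose circuit has all inputs of that node among
its open wires. -/
theorem exists_partial {S : Finset V} (hS : ∀ a b, G.edge a b → b ∈ S → a ∈ S) :
    ∃ L f, M.Partial S L f := by
  induction hn : S.card generalizing S with
  | zero =>
    obtain rfl := Finset.card_eq_zero.1 hn
    exact ⟨_, _, .empty⟩
  | succ n ih =>
    obtain ⟨v, hv, hmax⟩ := G.exists_maximal (S := (S : Set V))
      (Finset.coe_nonempty.2 (Finset.card_pos.1 (by omega)))
    rw [Finset.mem_coe] at hv
    obtain ⟨L, f, hf⟩ := ih (S := S.erase v) (fun a b hab hb => by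
      rw [Finset.mem_erase] at hb ⊢
      refine ⟨?_, hS a b hab hb.2⟩
      rintro rfl
      exact hmax b hb.2 hab) (by rw [Finset.card_erase_of_mem hv]; omega)
    have hpar : ∀ a, G.edge a v → a ∈ S.erase v := fun a ha =>
      Finset.mem_erase.2 ⟨fun h => G.not_edge_self v (h ▸ ha), hS a v ha hv⟩
    obtain ⟨R, hR⟩ := (G.nodup_inWires v).exists_perm_append (R := L) fun e he => by
      rw [G.mem_inWires] at he
      exact hf.subcircuit.mem_iff.2 ⟨hpar _ (he ▸ e.2.1), by simp [he]⟩
    obtain ⟨σ, hσ⟩ := Rewiring.exists_of_perm (sys := M.sys) hR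
    have := (hf.rewire hσ).node v (Finset.notMem_erase v S) hpar
    rw [Finset.insert_erase hv] at this
    exact ⟨_, _, this⟩

theorem exists_realises : ∃ P, M.Realises P := by
  obtain ⟨L, f, hf⟩ := M.exists_partial (S := Finset.univ) (by simp)
  have : L = [] := List.eq_nil_iff_forall_not_mem.2 fun e he => by
    simpa using hf.subcircuit.mem_iff.1 he
  subst this
  exact ⟨_, f, hf, fun _ => rfl⟩

theorem Partial.edge_mem {M : CircuitModel T G Ω} {S : Finset V} {L : List G.UEdge}
    {f : (∀ i, Ω i) → (𝟙_ C ⟶ composite M.sys L)} (h : M.Partial S L f) {a b : V}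
    (hab : G.edge a b) (hb : b ∈ S) : a ∈ S := by
  induction h with
  | empty => simp at hb
  | rewire _ _ ih => exact ih hb
  | node v _ hv _ ih =>
    rcases Finset.mem_insert.1 hb with rfl | hb
    · exact Finset.mem_insert_of_mem (hv a hab)
    · exact Finset.mem_insert_of_mem (ih hb)

end CircuitModel

/-! ### Feeding chains from failure of d-separation. -/

namespace GDAG

variable {V : Type w} (G : GDAG V) (Z : Set V)

/-- There is a directed path from `s` to `v` whose nodes before `v` are not in `Z`, and `s` is not
in `Z` either. -/
def Feeds (s v : V) : Prop :=
  s ∉ Z ∧ Relation.ReflTransGen (fun a b => G.edge a b ∧ a ∉ Z) s v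

variable {G Z}

theorem Feeds.refl {v : V} (hv : v ∉ Z) : G.Feeds Z v v := ⟨hv, .refl⟩

theorem Feeds.reflTransGen {s v : V} (h : G.Feeds Z s v) : Relation.ReflTransGen G.edge s v :=
  Relation.ReflTransGen.mono (fun _ _ h => h.1) s v h.2

theorem feeds_iff {s v : V} :
    G.Feeds Z s v ↔ (s = v ∧ v ∉ Z) ∨ ∃ p, (G.edge p v ∧ p ∉ Z) ∧ G.Feeds Z s p := by
  constructor
  · rintro ⟨hs, h⟩
    rcases h.cases_tail with rfl | ⟨p, hp, hpv⟩
    · exact .inl ⟨rfl, hs⟩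
    · exact .inr ⟨p, hpv, hs, hp⟩
  · rintro (⟨rfl, h⟩ | ⟨p, hpv, hs, hp⟩)
    · exact .refl h
    · exact ⟨hs, hp.tail hpv⟩

/-- If `X` and `Y` are not d-separated by `Z`, then they are linked by a chain of nodes of which the
first feeds `X`, the last feeds `Y`, and consecutive ones feed a common node of `Z`. -/
theorem exists_chain_of_not_dSep {X Y : Set V} (hXZ : Disjoint X Z) (h : ¬ G.DSep X Y Z) :
    ∃ x ∈ X, ∃ y ∈ Y, ∃ s t, G.Feeds Z s x ∧ G.Feeds Z t y ∧
      Relation.ReflTransGen (fun p p' => ∃ z ∈ Z, G.Feeds Z p z ∧ G.Feeds Z p' z) s t := by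
  by_contra H
  refine h fun a ha b hb l hl hla hlb => ?_
  by_contra hlZ
  push Not at hlZ
  -- The nodes linked to `X` by a chain. If none of them feeds `Y`, then `T` is closed under
  -- pseudo-path steps off `Z`, so it contains `b`, which feeds itself.
  let T : Set V := {t | ∃ x ∈ X, ∃ s, G.Feeds Z s x ∧
    Relation.ReflTransGen (fun p p' => ∃ z ∈ Z, G.Feeds Z p z ∧ G.Feeds Z p' z) s t}
  have hTY : ∀ t ∈ T, ∀ y ∈ Y, ¬ G.Feeds Z t y := fun t ⟨x, hx, s, hs, hst⟩ y hy ht =>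
    H ⟨x, hx, y, hy, s, t, hs, ht, hst⟩
  -- Follow a directed path towards `X ∪ Y ∪ Z` and stop early at the first node of `Z`.
  have hdesc : ∀ v ∈ G.inclusiveAncestors (X ∪ Y ∪ Z), ∃ c ∈ X ∪ Y ∪ Z,
      Relation.ReflTransGen (fun a b => G.edge a b ∧ a ∉ Z) v c := by
    rintro v ⟨c, hc, hvc⟩
    induction hvc using Relation.ReflTransGen.head_induction_on with
    | refl => exact ⟨c, hc, .refl⟩
    | @head v w hvw _ ih =>
      by_cases hv : v ∈ Z
      · exact ⟨v, .inr hv, .refl⟩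
      · exact ih.imp fun d ⟨hd, hwd⟩ => ⟨hd, .head ⟨hvw, hv⟩ hwd⟩
  have hstep : ∀ p p', ¬ (G.inclusiveChildren {p} ∩ G.inclusiveChildren {p'} ⊆
      (G.inclusiveAncestors (X ∪ Y ∪ Z))ᶜ) → p ∉ Z → p' ∉ Z → p ∈ T → p' ∈ T := by
    intro p p' hpp hp hp' hpT
    obtain ⟨v, ⟨hv, hv'⟩, hvA⟩ := Set.not_subset.1 hpp
    obtain ⟨c, hc, hvc⟩ := hdesc v (not_not.1 hvA)
    have hfeed : ∀ q ∉ Z, v ∈ G.inclusiveChildren {q} → G.Feeds Z q c := fun q hq hvq => by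
      rcases hvq with rfl | ⟨_, rfl, hqv⟩
      · exact ⟨hq, hvc⟩
      · exact ⟨hq, .head ⟨hqv, hq⟩ hvc⟩
    -- Reaching `X` starts a new chain at `p'`, reaching `Y` is excluded, and reaching `Z` gives the
    -- next link from `p` to `p'`.
    rcases hc with (hc | hc) | hc
    · exact ⟨c, hc, p', hfeed p' hp' hv', .refl⟩
    · exact absurd (hfeed p hp hv) (hTY p hpT c hc)
    · obtain ⟨x, hx, s, hs, hsp⟩ := hpT
      exact ⟨x, hx, s, hs, hsp.tail ⟨c, hc, hfeed p hp hv, hfeed p' hp' hv'⟩⟩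
  have hall : ∀ l : List V, l.IsChain (fun a b => ¬ (G.inclusiveChildren {a} ∩
      G.inclusiveChildren {b} ⊆ (G.inclusiveAncestors (X ∪ Y ∪ Z))ᶜ)) → (∀ v ∈ l, v ∉ Z) →
      (∀ v, l.head? = some v → v ∈ T) → ∀ v ∈ l, v ∈ T := by
    intro l hl hlZ hhead
    induction l with
    | nil => simp
    | cons p l ih =>
      have hp : p ∈ T := hhead p rfl
      intro v hv
      rcases List.mem_cons.1 hv with rfl | hv
      · exact hp
      cases l with
      | nil => simp at hv
      | cons p' l =>
        rw [List.isChain_cons_cons] at hl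
        refine ih hl.2 (fun v hv => hlZ v (List.mem_cons_of_mem _ hv)) (fun w hw => ?_) v hv
        obtain rfl : p' = w := by simpa using hw
        exact hstep p p' hl.1 (hlZ p (by simp)) (hlZ p' (by simp)) hp
  have hbl : b ∈ l := List.mem_of_getLast? hlb
  refine hTY b (hall l hl.2 hlZ (fun v hv => ?_) b hbl) b hb (.refl (hlZ b hbl))
  obtain rfl : a = v := by simpa [hla] using hv
  exact ⟨a, ha, a, .refl (Set.disjoint_left.1 hXZ ha), .refl⟩

/-! ### Bits propagated through the graph. -/

section FeedValue

open Classical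

variable (G Z)

/-- The value a node `v` computes from its own bit `β` and the union `s` of the values of its
parents outside `Z`: nodes outside `Z` collect the bits, those in `Z` tell whether both bits
occur. -/
noncomputable def nodeValue (v : V) (β : Bool) (s : Finset Bool) : Finset Bool :=
  if v ∈ Z then if s = Finset.univ then Finset.univ else ∅ else insert β s

/-- The bits `r s` of the nodes `s` that feed `v`. -/
noncomputable def feed (r : V → Bool) (v : V) : Finset Bool :=
  {b | ∃ s, G.Feeds Z s v ∧ r s = b}

/-- The values of all nodes, given the bits `r` of all nodes. -/
noncomputable def feedValue (r : V → Bool) (v : V) : Finset Bool :=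
  if v ∈ Z then if G.feed Z r v = Finset.univ then Finset.univ else ∅ else G.feed Z r v

variable {G Z}

theorem mem_feed {r : V → Bool} {v : V} {b : Bool} :
    b ∈ G.feed Z r v ↔ ∃ s, G.Feeds Z s v ∧ r s = b := by
  simp [feed]

theorem feedValue_of_notMem {r : V → Bool} {v : V} (hv : v ∉ Z) :
    G.feedValue Z r v = G.feed Z r v := if_neg hv

theorem feedValue_congr {r r' : V → Bool} {v : V}
    (h : ∀ s, Relation.ReflTransGen G.edge s v → r s = r' s) :
    G.feedValue Z r v = G.feedValue Z r' v := by
  have : G.feed Z r v = G.feed Z r' v := by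
    ext b
    rw [mem_feed, mem_feed]
    exact exists_congr fun s => and_congr_right fun hs => by rw [h s hs.reflTransGen]
  rw [feedValue, feedValue, this]

/-- A feeding path is either trivial or has a last step from a parent outside `Z`, so the global
description by paths satisfies the local rule by which the nodes compute. -/
theorem feedValue_eq_nodeValue {r : V → Bool} {v : V} {s : Finset Bool}
    (hs : ∀ b, b ∈ s ↔ ∃ p, (G.edge p v ∧ p ∉ Z) ∧ b ∈ G.feedValue Z r p) :
    G.feedValue Z r v = nodeValue Z v (r v) s := by
  have hs' : ∀ b, b ∈ s ↔ ∃ p, (G.edge p v ∧ p ∉ Z) ∧ ∃ t, G.Feeds Z t p ∧ r t = b := fun b => by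
    rw [hs]
    exact exists_congr fun p => and_congr_right fun hp => by
      rw [feedValue_of_notMem hp.2, mem_feed]
  have hf : ∀ b, b ∈ G.feed Z r v ↔ (v ∉ Z ∧ r v = b) ∨ b ∈ s := fun b => by
    rw [mem_feed, hs']
    constructor
    · rintro ⟨t, ht, hb⟩
      rcases feeds_iff.1 ht with ⟨rfl, hv⟩ | ⟨p, hp, hpt⟩
      · exact .inl ⟨hv, hb⟩
      · exact .inr ⟨p, hp, t, hpt, hb⟩
    · rintro (⟨hv, hb⟩ | ⟨p, hp, t, ht, hb⟩)
      · exact ⟨v, .refl hv, hb⟩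
      · exact ⟨t, feeds_iff.2 (.inr ⟨p, hp, ht⟩), hb⟩
  by_cases hv : v ∈ Z
  · have : G.feed Z r v = s := by
      ext b
      simp [hf, hv]
    rw [feedValue, nodeValue, if_pos hv, if_pos hv, this]
  · rw [feedValue, nodeValue, if_neg hv, if_neg hv]
    ext b
    rw [hf, Finset.mem_insert]
    simp [hv, eq_comm]

theorem feed_const_subset (b : Bool) (v : V) : G.feed Z (fun _ => b) v ⊆ {b} := by
  intro c hc
  obtain ⟨_, _, rfl⟩ := mem_feed.1 hc
  simp

theorem feedValue_const_of_mem (b : Bool) {v : V} (hv : v ∈ Z) :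
    G.feedValue Z (fun _ => b) v = ∅ := by
  rw [feedValue, if_pos hv, if_neg]
  intro h
  have := feed_const_subset (G := G) (Z := Z) b v (h ▸ Finset.mem_univ (!b))
  simp at this

end FeedValue

end GDAG

/-! ### Supports of matrices on labelled wires. -/

namespace WeightMat

variable {A B D F : WeightMat.{u}}

theorem comp_ne_zero {f : A ⟶ B} {g : B ⟶ D} {a : A.carrier} {c : D.carrier} :
    (f ≫ g) a c ≠ 0 ↔ ∃ b, f a b ≠ 0 ∧ g b c ≠ 0 := by
  rw [comp_apply, ne_eq, ENNReal.tsum_eq_zero]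
  push Not
  simp only [mul_ne_zero_iff]

theorem ofFun_ne_zero {φ : A.carrier → B.carrier} {a : A.carrier} {b : B.carrier} :
    (ofFun φ : A ⟶ B) a b ≠ 0 ↔ b = φ a := by
  simp [ofFun, eq_comm]

theorem id_ne_zero {a b : A.carrier} : (𝟙 A : A ⟶ A) a b ≠ 0 ↔ b = a :=
  ofFun_ne_zero (φ := id)

theorem whiskerLeft_ne_zero {f : A ⟶ B} {a : D.carrier × A.carrier} {b : D.carrier × B.carrier} :
    (D ◁ f : D ⊗ A ⟶ D ⊗ B) a b ≠ 0 ↔ b.1 = a.1 ∧ f a.2 b.2 ≠ 0 :=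
  mul_ne_zero_iff.trans (and_congr_left' id_ne_zero)

theorem whiskerRight_ne_zero {f : A ⟶ B} {a : A.carrier × D.carrier} {b : B.carrier × D.carrier} :
    (f ▷ D : A ⊗ D ⟶ B ⊗ D) a b ≠ 0 ↔ f a.1 b.1 ≠ 0 ∧ b.2 = a.2 :=
  mul_ne_zero_iff.trans (and_congr_right' id_ne_zero)

section Points

variable {E : Type w} {κ : Type u}

/-- The assignment of the same system to all wires. -/
abbrev constSys (E : Type w) (κ : Type u) : E → WeightMat.{u} := fun _ => ⟨κ⟩

/-- The element of a composite of copies of `κ` with prescribed values on the wires. -/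
def point (y : E → κ) : ∀ L : List E, (composite (constSys E κ) L).carrier
  | [] => PUnit.unit
  | e :: L => (y e, point y L)

open Classical in
/-- The value on the wire `e`, if it is in the list. -/
noncomputable def readWire [Inhabited κ] (e : E) :
    ∀ L : List E, (composite (constSys E κ) L).carrier → κ
  | [], _ => default
  | e' :: L, q => if e = e' then q.1 else readWire e L q.2

theorem readWire_point [Inhabited κ] (y : E → κ) {e : E} {L : List E} (he : e ∈ L) :
    readWire e L (point y L) = y e := by
  induction L with
  | nil => cases he
  | cons e' L ih =>
    by_cases h : e = e'
    · subst h
      exact if_pos rfl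
    · exact (if_neg h).trans (ih ((List.mem_cons.1 he).resolve_left h))

theorem point_congr {y y' : E → κ} {L : List E} (h : ∀ e ∈ L, y e = y' e) :
    point y L = point y' L := by
  induction L with
  | nil => rfl
  | cons e L ih =>
    exact Prod.ext (h e List.mem_cons_self) (ih fun e he => h e (List.mem_cons_of_mem _ he))

/-- A `point` assigns values to wires by label, so permuting the wires turns it into the point of
the same assignment. -/
theorem rewiring_point_ne_zero {L L' : List E}
    {σ : composite (constSys E κ) L ⟶ composite (constSys E κ) L'}
    (hσ : Rewiring (constSys E κ) L L' σ) (y : E → κ)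
    (q : (composite (constSys E κ) L').carrier) :
    σ (point y L) q ≠ 0 ↔ q = point y L' := by
  induction hσ with
  | nil => exact id_ne_zero
  | cons e _ ih =>
    refine whiskerLeft_ne_zero.trans ((and_congr_right' (ih _)).trans ⟨fun h => ?_, fun h => ?_⟩)
    · exact Prod.ext h.1 h.2
    · subst h
      exact ⟨rfl, rfl⟩
  | swap e e' L =>
    refine Iff.trans comp_ne_zero ?_
    constructor
    · rintro ⟨p, hp, h⟩
      obtain ⟨p', hp', h'⟩ := comp_ne_zero.1 h
      obtain rfl := ofFun_ne_zero.1 hp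
      obtain ⟨h1, h2⟩ := whiskerRight_ne_zero.1 hp'
      have h1' := ofFun_ne_zero.1 h1
      obtain rfl := ofFun_ne_zero.1 h'
      obtain ⟨p1, p2⟩ := p'
      subst h1' h2
      rfl
    · rintro rfl
      exact ⟨_, ofFun_ne_zero.2 rfl, comp_ne_zero.2
        ⟨((y e', y e), point y L), whiskerRight_ne_zero.2 ⟨ofFun_ne_zero.2 rfl, rfl⟩,
          ofFun_ne_zero.2 rfl⟩⟩
  | trans _ _ ih ih' =>
    rw [comp_ne_zero]
    constructor
    · rintro ⟨p, hp, h⟩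
      obtain rfl := (ih p).1 hp
      exact (ih' q).1 h
    · rintro rfl
      exact ⟨_, (ih _).2 rfl, (ih' _).2 rfl⟩

theorem compositeAppend_hom_point_ne_zero (y : E → κ) (R L : List E)
    (q : (composite (constSys E κ) L ⊗
      composite (constSys E κ) R).carrier) :
    (compositeAppend (constSys E κ) R L).hom (point y (L ++ R)) q ≠ 0 ↔
      q = (point y L, point y R) := by
  induction L with
  | nil => exact ofFun_ne_zero
  | cons e L ih =>
    refine Iff.trans (comp_ne_zero (f := _ ◁ _) (g := (α_ _ _ _).inv)) ?_
    constructor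
    · rintro ⟨p, hp, h⟩
      obtain ⟨h1, h2⟩ := whiskerLeft_ne_zero.1 hp
      have h2' := (ih _).1 h2
      obtain rfl := ofFun_ne_zero.1 h
      obtain ⟨p1, p2⟩ := p
      cases h1
      cases h2'
      rfl
    · rintro rfl
      exact ⟨(y e, point y L, point y R), whiskerLeft_ne_zero.2 ⟨rfl, (ih _).2 rfl⟩,
        ofFun_ne_zero.2 rfl⟩

theorem compositeAppend_inv_point_ne_zero (y : E → κ) (R L : List E)
    (q : (composite (constSys E κ) (L ++ R)).carrier) :
    (compositeAppend (constSys E κ) R L).inv (point y L, point y R) q ≠ 0 ↔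
      q = point y (L ++ R) := by
  induction L with
  | nil => exact ofFun_ne_zero
  | cons e L ih =>
    refine Iff.trans (comp_ne_zero (f := (α_ _ _ _).hom) (g := _ ◁ _)) ?_
    constructor
    · rintro ⟨p, hp, h⟩
      obtain rfl := ofFun_ne_zero.1 hp
      obtain ⟨h1, h2⟩ := whiskerLeft_ne_zero.1 h
      exact Prod.ext h1 ((ih _).1 h2)
    · rintro rfl
      exact ⟨(y e, point y L, point y R), ofFun_ne_zero.2 rfl,
        whiskerLeft_ne_zero.2 ⟨rfl, (ih _).2 rfl⟩⟩

end Points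

end WeightMat

/-- Each `c` contributes `k` at exactly one pair; with the two values of a fair bit this makes the
nodes of `feedModel` stochastic. -/
theorem tsum_indicator_pair {α β γ : Type*} (φ : γ → α) (ψ : γ → β) (k : ENNReal)
    [∀ a b c, Decidable (a = φ c ∧ b = ψ c)] :
    ∑' a, ∑' b, ∑' c, (if a = φ c ∧ b = ψ c then k else 0) = ∑' _ : γ, k := by
  classical
  calc _ = ∑' a, ∑' c, ∑' b, (if a = φ c ∧ b = ψ c then k else 0) :=
        tsum_congr fun a => ENNReal.tsum_comm
    _ = ∑' a, ∑' c, (if a = φ c then k else 0) :=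
        tsum_congr fun a => tsum_congr fun c => by
          rw [tsum_eq_single (ψ c) fun b hb => if_neg fun h => hb h.2]
          simp
    _ = ∑' c, ∑' a, (if a = φ c then k else 0) := ENNReal.tsum_comm
    _ = _ := tsum_congr fun c => by simp

/-! ### The bit-propagation model and its support. -/

namespace GDAG

open WeightMat Classical

variable {V : Type w} [Fintype V] [DecidableEq V] (G : GDAG V) (Z : Set V)

/-- The union of the values that `v` receives from its parents outside `Z`. -/
noncomputable def receivedValue (v : V) (c : G.ParentValue (fun _ => Finset Bool) v)
    (q : (composite (constSys G.UEdge (ULift.{u} (Finset Bool)))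
      (G.inWires v)).carrier) : Finset Bool :=
  {b | (∃ j, (j.1 : V) ∉ Z ∧ b ∈ c j) ∨ ∃ e : G.UEdge, e.1.2 = v ∧ b ∈ (readWire e _ q).down}

/-- The classical model in which every node draws a uniformly random bit and computes its value by
`nodeValue`; unobserved nodes send their value along all outgoing edges. -/
noncomputable def feedModel :
    CircuitModel classicalOPT.{u} G (fun _ : G.observed => Finset Bool) where
  sys := constSys G.UEdge (ULift.{u} (Finset Bool))
  test v c o q q' := ∑' β : Bool,
    if o = (fun _ => nodeValue Z v β (G.receivedValue Z v c q)) ∧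
      q' = point (fun _ => ⟨nodeValue Z v β (G.receivedValue Z v c q)⟩) _ then 2⁻¹ else 0
  isTest v c := by
    intro q
    refine (tsum_indicator_pair _ _ _).trans ?_
    rw [tsum_bool, ENNReal.inv_two_add_inv_two]

variable {G Z}

theorem feedModel_test_ne_zero {v : V} {c : G.ParentValue (fun _ => Finset Bool) v}
    {o : G.Outcome (fun _ => Finset Bool) v}
    {q : (composite (feedModel.{u} G Z).sys (G.inWires v)).carrier}
    {q' : (composite (feedModel.{u} G Z).sys (G.outWires v)).carrier} :
    (feedModel.{u} G Z).test v c o q q' ≠ 0 ↔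
      ∃ β, o = (fun _ => nodeValue Z v β (G.receivedValue Z v c q)) ∧
        q' = point (fun _ => ⟨nodeValue Z v β (G.receivedValue Z v c q)⟩) _ := by
  refine (ENNReal.tsum_eq_zero.not).trans ?_
  push Not
  exact exists_congr fun β => ite_ne_right_iff.trans (and_iff_left (by simp))

/-- If the observed parents of `v` have the values prescribed by `r` and the wires carry those
values too, then `v` computes the value prescribed by `r`. -/
theorem feedValue_eq_nodeValue_receivedValue (hZ : Z ⊆ G.observed) {r : V → Bool} {v : V}
    {c : G.ParentValue (fun _ => Finset Bool) v} (hc : ∀ j, c j = G.feedValue Z r j.1) :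
    G.feedValue Z r v = nodeValue Z v (r v)
      (G.receivedValue.{u} Z v c (point (fun e => ⟨G.feedValue Z r e.1.1⟩) _)) := by
  refine feedValue_eq_nodeValue fun b => ?_
  simp only [receivedValue, Finset.mem_filter, Finset.mem_univ, true_and]
  constructor
  · rintro (⟨j, hj, hb⟩ | ⟨e, he, hb⟩)
    · exact ⟨j.1, ⟨j.2, hj⟩, hc j ▸ hb⟩
    · rw [readWire_point _ (G.mem_inWires.2 he)] at hb
      exact ⟨e.1.1, ⟨he ▸ e.2.1, fun h => e.2.2 (hZ h)⟩, hb⟩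
  · rintro ⟨p, ⟨hp, hpZ⟩, hb⟩
    by_cases ho : p ∈ G.observed
    · exact .inl ⟨⟨⟨p, ho⟩, hp⟩, hpZ, (hc _).symm ▸ hb⟩
    · let e : G.UEdge := ⟨(p, v), hp, ho⟩
      refine .inr ⟨e, rfl, ?_⟩
      rwa [readWire_point _ (G.mem_inWires.2 (rfl : e.1.2 = v))]

/-- A run of the circuit has positive probability exactly when one choice of bits explains all
observed values and all open wires simultaneously; each new node adds its own bit to that choice. -/
theorem feedModel_partial_ne_zero (hZ : Z ⊆ G.observed) {S : Finset V} {L : List G.UEdge}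
    {f : (G.observed → Finset Bool) → (𝟙_ WeightMat.{u} ⟶ composite (feedModel.{u} G Z).sys L)}
    (hf : (feedModel.{u} G Z).Partial S L f) (x : G.observed → Finset Bool)
    (q : (composite (feedModel.{u} G Z).sys L).carrier) :
    f x PUnit.unit q ≠ 0 ↔ ∃ r : V → Bool,
      (∀ i : G.observed, (i : V) ∈ S → x i = G.feedValue Z r i) ∧
        q = point (fun e => ⟨G.feedValue Z r e.1.1⟩) L := by
  induction hf with
  | empty =>
    refine id_ne_zero.trans ?_
    simp only [Finset.notMem_empty, false_imp_iff, implies_true, true_and]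
    exact ⟨fun h => ⟨fun _ => false, h⟩, fun ⟨_, h⟩ => h⟩
  | rewire h hσ ih =>
    rw [comp_ne_zero]
    constructor
    · rintro ⟨p, hp, h⟩
      obtain ⟨r, hr, rfl⟩ := (ih p).1 hp
      exact ⟨r, hr, (rewiring_point_ne_zero hσ _ q).1 h⟩
    · rintro ⟨r, hr, rfl⟩
      exact ⟨_, (ih _).2 ⟨r, hr, rfl⟩, (rewiring_point_ne_zero hσ _ _).2 rfl⟩
  | @node S v R f hv hpar h ih =>
    have hsrc : ∀ e ∈ R, e.1.1 ∈ S := fun e he =>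
      (h.subcircuit.mem_iff.1 (List.mem_append_right _ he)).1
    rw [comp_ne_zero]
    constructor
    · rintro ⟨p, hp, hp'⟩
      obtain ⟨r, hr, rfl⟩ := (ih p).1 hp
      obtain ⟨p₁, hp₁, hp₁'⟩ := comp_ne_zero.1 hp'
      obtain ⟨p₂, hp₂, hp₂'⟩ := comp_ne_zero.1 hp₁'
      obtain rfl := (compositeAppend_hom_point_ne_zero
        (fun e : G.UEdge => (⟨G.feedValue Z r e.1.1⟩ : ULift.{u} (Finset Bool)))
        R (G.inWires v) p₁).1 hp₁
      obtain ⟨h₁, h₂⟩ := whiskerRight_ne_zero.1 hp₂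
      obtain ⟨β, hβ, hβ'⟩ := feedModel_test_ne_zero.1 h₁
      -- The set `S` is ancestral and omits `v`, so the bit newly drawn at `v` influences no earlier
      -- value.
      have hS : ∀ p ∈ S, G.feedValue Z (Function.update r v β) p = G.feedValue Z r p :=
        fun p hp => feedValue_congr fun s hs => Function.update_of_ne (fun hsv => hv (by
          rw [← hsv]
          clear hsv
          induction hs using Relation.ReflTransGen.head_induction_on with
          | refl => exact hp
          | head hab _ ih => exact h.edge_mem hab ih)) _ _
      have hin : point (fun e : G.UEdge =>
          (⟨G.feedValue Z (Function.update r v β) e.1.1⟩ : ULift.{u} (Finset Bool)))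
          (G.inWires v) = point (fun e => ⟨G.feedValue Z r e.1.1⟩) (G.inWires v) :=
        point_congr fun e he => by rw [hS _ (hpar _ (G.mem_inWires.1 he ▸ e.2.1))]
      have hval := feedValue_eq_nodeValue_receivedValue.{u} hZ (r := Function.update r v β)
        (c := fun j : {j : G.observed // G.edge j v} => x j.1)
        fun j => by rw [hS _ (hpar _ j.2), hr j.1 (hpar _ j.2)]
      rw [Function.update_self, hin] at hval
      refine ⟨Function.update r v β, fun i hi => ?_, ?_⟩
      · rcases Finset.mem_insert.1 hi with hi | hi
        · obtain ⟨i, ho⟩ := i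
          subst hi
          exact (congrFun hβ ho).trans hval.symm
        · rw [hS _ hi, hr i hi]
      · have hp₂_eq : p₂ = (point (fun e => ⟨G.feedValue Z (Function.update r v β) e.1.1⟩)
            (G.outWires v), point (fun e => ⟨G.feedValue Z (Function.update r v β) e.1.1⟩) R) := by
          refine Prod.ext ?_ ?_
          · refine hβ'.trans (point_congr fun e he => ?_)
            rw [G.mem_outWires.1 he, hval]
          · refine h₂.trans (point_congr fun e he => ?_)
            rw [hS _ (hsrc e he)]
        subst hp₂_eq
        exact (compositeAppend_inv_point_ne_zero _ R (G.outWires v) q).1 hp₂'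
    · rintro ⟨r, hr, rfl⟩
      have hc : ∀ j : {j : G.observed // G.edge j v}, x j.1 = G.feedValue Z r j.1 := fun j =>
        hr j.1 (Finset.mem_insert_of_mem (hpar _ j.2))
      have hval := feedValue_eq_nodeValue_receivedValue.{u} hZ hc
      refine ⟨_, (ih _).2 ⟨r, fun i hi => hr i (Finset.mem_insert_of_mem hi), rfl⟩,
        comp_ne_zero.2 ⟨_, (compositeAppend_hom_point_ne_zero _ R _ _).2 rfl,
          comp_ne_zero.2 ⟨(point (fun e => ⟨G.feedValue Z r e.1.1⟩) _, _),
            whiskerRight_ne_zero.2 ⟨feedModel_test_ne_zero.2 ⟨r v, ?_, ?_⟩, rfl⟩,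
            (compositeAppend_inv_point_ne_zero _ R _ _).2 rfl⟩⟩⟩
      · funext ho
        exact (hr ⟨v, ho⟩ (Finset.mem_insert_self _ _)).trans hval
      · refine point_congr fun e he => ?_
        rw [G.mem_outWires.1 he, hval]

end GDAG

/-! ### Completeness and the main theorem. -/

namespace GDAG

open WeightMat

variable {V : Type w} [Fintype V] [DecidableEq V] {G : GDAG V} {X Y Z : Set V}

theorem feedModel_realises_ne_zero (hZ : Z ⊆ G.observed) {P : (G.observed → Finset Bool) → ℝ}
    (hP : (feedModel.{u} G Z).Realises P) (x : G.observed → Finset Bool) :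
    P x ≠ 0 ↔ ∃ r : V → Bool, ∀ i : G.observed, x i = G.feedValue Z r i := by
  obtain ⟨f, hf, hPf⟩ := hP
  obtain ⟨_, _, t, ht, y, hy⟩ := hf.subcircuit.isEvent x
  -- An infinite entry would be sent to zero by `toReal`.
  have htop : f x PUnit.unit PUnit.unit ≠ ⊤ := by
    rw [← hy]
    exact ne_top_of_le_ne_top ENNReal.one_ne_top
      ((ENNReal.le_tsum PUnit.unit).trans (IsInstrument.tsum_le_one ht y PUnit.unit))
  have hne := feedModel_partial_ne_zero hZ hf x PUnit.unit
  rw [hPf]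
  refine (ENNReal.toReal_ne_zero.trans (and_iff_left htop)).trans (hne.trans ?_)
  simp only [Finset.mem_univ, true_imp_iff]
  exact exists_congr fun r => and_iff_left rfl

/-- Completeness of d-separation. -/
theorem exists_isGeneralisedMarkov_not_condIndepSets (hX : X ⊆ G.observed) (hY : Y ⊆ G.observed)
    (hZ : Z ⊆ G.observed) (hXY : Disjoint X Y) (hXZ : Disjoint X Z) (hYZ : Disjoint Y Z)
    (h : ¬ G.DSep X Y Z) :
    ∃ P : (G.observed → Finset Bool) → ℝ, P ∈ stdSimplex ℝ (G.observed → Finset Bool) ∧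
      G.IsGeneralisedMarkov.{u, w} (Ω := fun _ => Finset Bool) P ∧
      ¬ CondIndepSets (Ω := fun _ => Finset Bool) P X Y Z := by
  classical
  obtain ⟨x, hx, y, hy, s, t, hsx, hty, hst⟩ := exists_chain_of_not_dSep hXZ h
  obtain ⟨P, hP⟩ := (feedModel.{u} G Z).exists_realises
  have hsimp : P ∈ stdSimplex ℝ (G.observed → Finset Bool) := hP.mem_stdSimplex
  have hsupp := feedModel_realises_ne_zero hZ hP
  refine ⟨P, hsimp, ⟨_, _, _, _, _, _, hP⟩, fun hind => ?_⟩
  -- On `X` these are the values for constant bits `false`, on `Y` those for constant bits `true`,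
  -- and on `Z` they are `∅`, as for either constant. No choice of bits yields all three at once.
  let a : G.observed → Finset Bool := fun i => G.feedValue Z (fun _ => decide ((i : V) ∈ Y)) i
  have hpos : ∀ (S : Set V) (b : Bool),
      (∀ i : G.observed, (i : V) ∈ S → G.feedValue Z (fun _ => b) i = a i) →
      marginal (Ω := fun _ => Finset Bool) P S a ≠ 0 := by
    intro S b hS
    refine ne_of_gt (Finset.sum_pos' (fun x _ => hsimp.1 x)
      ⟨fun i => G.feedValue Z (fun _ => b) i, ?_, ?_⟩)
    · simpa using hS
    · exact lt_of_le_of_ne (hsimp.1 _) ((hsupp _).2 ⟨_, fun _ => rfl⟩).symm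
  have hZa : ∀ (b : Bool) (i : G.observed), (i : V) ∈ Z → G.feedValue Z (fun _ => b) i = a i :=
    fun b i hi => by simp only [a, feedValue_const_of_mem _ hi]
  have hXa : ∀ i : G.observed, (i : V) ∈ X → G.feedValue Z (fun _ => false) i = a i :=
    fun i hi => by simp only [a, Set.disjoint_left.1 hXY hi, decide_false]
  have hYa : ∀ i : G.observed, (i : V) ∈ Y → G.feedValue Z (fun _ => true) i = a i :=
    fun i hi => by simp only [a, hi, decide_true]
  have h0 := hpos Z false (hZa false)
  have h1 := hpos (X ∪ Z) false fun i hi => hi.elim (hXa i) (hZa false i)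
  have h2 := hpos (Y ∪ Z) true fun i hi => hi.elim (hYa i) (hZa true i)
  have h3 : marginal (Ω := fun _ => Finset Bool) P (X ∪ Y ∪ Z) a = 0 := by
    refine Finset.sum_eq_zero fun v hv => ?_
    simp only [Finset.mem_filter, Finset.mem_univ, true_and] at hv
    by_contra hne
    obtain ⟨r, hr⟩ := (hsupp v).1 hne
    have hra : ∀ i : G.observed, (i : V) ∈ X ∪ Y ∪ Z → G.feedValue Z r i = a i := fun i hi =>
      (hr i).symm.trans (hv i hi)
    -- Value `∅` at a node of `Z` says that the bits feeding it all agree, so equality is carried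
    -- along the chain.
    have hrst : r s = r t := by
      clear hty
      induction hst with
      | refl => rfl
      | tail _ hpp ih =>
        obtain ⟨z, hz, hp, hp'⟩ := hpp
        rw [ih]
        by_contra hne
        have hz' := hra ⟨z, hZ hz⟩ (.inr hz)
        rw [← hZa false ⟨z, hZ hz⟩ hz, feedValue_const_of_mem _ hz, feedValue, if_pos hz,
          if_pos] at hz'
        · simp at hz'
        · ext b
          simp only [Finset.mem_univ, iff_true]
          refine mem_feed.2 ?_
          rename_i p p' _
          by_cases hb : r p = b
          · exact ⟨p, hp, hb⟩
          · exact ⟨p', hp', by revert hne hb; cases r p <;> cases r p' <;> cases b <;> simp⟩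
    -- The bit of `s` reaches `x`, where only `false` is seen.
    have hs : r s = false := by
      have := hra ⟨x, hX hx⟩ (.inl (.inl hx))
      rw [← hXa ⟨x, hX hx⟩ hx] at this
      have hxZ := Set.disjoint_left.1 hXZ hx
      rw [feedValue_of_notMem hxZ, feedValue_of_notMem hxZ] at this
      have hmem : r s ∈ G.feed Z r x := mem_feed.2 ⟨s, hsx, rfl⟩
      exact Finset.mem_singleton.1 (feed_const_subset _ _ (this ▸ hmem))
    have ht : r t = true := by
      have := hra ⟨y, hY hy⟩ (.inl (.inr hy))
      rw [← hYa ⟨y, hY hy⟩ hy] at this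
      have hyZ := Set.disjoint_left.1 hYZ hy
      rw [feedValue_of_notMem hyZ, feedValue_of_notMem hyZ] at this
      have hmem : r t ∈ G.feed Z r y := mem_feed.2 ⟨t, hty, rfl⟩
      exact Finset.mem_singleton.1 (feed_const_subset _ _ (this ▸ hmem))
    rw [hs, ht] at hrst
    cases hrst
  have := hind a h0
  rw [h3, zero_div, eq_comm, mul_eq_zero] at this
  exact this.elim (div_ne_zero h1 h0) (div_ne_zero h2 h0)

end GDAG

theorem theorem3 {V : Type w} [Fintype V] [DecidableEq V] (G : GDAG V) (X Y Z : Set V)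
    (hX : X ⊆ G.observed) (hY : Y ⊆ G.observed) (hZ : Z ⊆ G.observed)
    (hXY : Disjoint X Y) (hXZ : Disjoint X Z) (hYZ : Disjoint Y Z) :
    (∀ (Ω : G.observed → Type) [∀ i, Fintype (Ω i)] (P : (∀ i, Ω i) → ℝ),
      P ∈ stdSimplex ℝ (∀ i, Ω i) → G.IsGeneralisedMarkov.{u, w} P →
      G.DSep X Y Z → CondIndepSets P X Y Z) ∧
    ((∀ (Ω : G.observed → Type) [∀ i, Fintype (Ω i)] (P : (∀ i, Ω i) → ℝ),
      P ∈ stdSimplex ℝ (∀ i, Ω i) → G.IsGeneralisedMarkov.{u, w} P →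
      CondIndepSets P X Y Z) → G.DSep X Y Z) := by
  refine ⟨fun Ω _ P _ hP hsep => hP.condIndepSets hZ hXZ hYZ hsep, fun h => ?_⟩
  by_contra hsep
  obtain ⟨P, hP, hM, hne⟩ :=
    GDAG.exists_isGeneralisedMarkov_not_condIndepSets.{u} hX hY hZ hXY hXZ hYZ hsep
  exact hne (h (fun _ => Finset Bool) P hP hM)
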